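/- **Setting.** Alice (party 1) and Bob (party 2) hold inputs $X\in\mathcal X$ and $Y\in\mathcal Y$; Charlie (party 3) has no input and produces an output $Z\in\mathcal Z$; the alphabets $\mathcal X,\mathcal Y,\mathcal Z$ are finite. A *protocol* $\Pi$ proceeds in synchronous rounds over private links $12$, $23$, $31$. In each round, each party $i$ sends a (possibly empty) bit string on each of its two links, drawn jointly from a distribution determined by party $i$'s input and the messages exchanged on party $i$'s two links in the previous rounds; given the state, the three parties draw their messages independently (there is no shared randomness). The protocol is *well-formed* if (i) the message sent by party $i$ to party $j$ in any round is a codeword of a prefix-free code that is determined by the messages exchanged between $i$ and $j$ in the previous rounds, and (ii) with probability $1$ it reaches a state from which on only empty strings are sent. The final transcript $M_{ij}$ of link $ij$ is the pair of bit strings obtained by concatenating, in each of the two directions, all bits sent on that link. Charlie's output is a randomized function of $(M_{23},M_{31})$. The protocol and the input distribution determine the joint law of $(X,Y,Z,M_{12},M_{23},M_{31})$. Write $M_1=(M_{12},M_{31})$, $M_2=(M_{12},M_{23})$, $M_3=(M_{23},M_{31})$. A *secure protocol* $\Pi(p_{XY},p_{Z|XY})$ is a well-formed protocol (which may depend on $p_{XY}$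 and $p_{Z|XY}$) that, when run on inputs $(X,Y)\sim p_{XY}$, satisfies * correctness: $(X,Y,Z)$ has joint law $p_{XYZ}=p_{XY}\,p_{Z|XY}$; * privacy: $M_1 - X - (Y,Z)$, $M_2 - Y - (X,Z)$ and $M_3 - Z - (X,Y)$ are Markov chains. The randomized function $p_{Z|XY}$ is in *normal form* if: $x=x'$ whenever $p(z|x,y)=p(z|x',y)$ for all $y,z$; $y=y'$ whenever $p(z|x,y)=p(z|x,y')$ for all $x,z$; and $z=z'$ whenever there is a constant $c$ with $p(z|x,y)=c\,p(z'|x,y)$ for all $x,y$. $H$ denotes Shannon entropy and $I$ mutual information, with logarithms to base $2$ (the entropy of a transcript may be $+\infty$). The *residual information* is $RI(U;V)=I(U;V)-H(U\sqcap V)$, where $H(U\sqcap V)$ is the Gács–Körner common information, i.e. the maximum of $H(Q)$ over all random variables $Q$ that are determined both by $U$ and by $V$ (there are functions $f,g$ with $Q=f(U)=g(V)$ almost surely). **Theorem.** Let $p_X$ and $p_Y$ have full support on $\mathcal X$ and $\mathcal Y$, and let $p_{Z|XY}$ be in normal form. Then any secure protocol $\Pi(p_Xp_Y,p_{Z|XY})$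 satisfies $$H(M_{23}) \ge RI(X;Z)+H(Y,Z|X),$$ $$H(M_{31}) \ge RI(Y;Z)+H(X,Z|Y),$$ $$H(M_{12}) \ge RI(X;Z)+RI(Y;Z)+H(X,Y|Z),$$ where the right-hand sides are evaluated for $(X,Y,Z)\sim p_Xp_Yp_{Z|XY}$. -/

import Mathlib

open scoped ENNReal

noncomputable section

namespace ThreeParty

/-! ### Information measures (logarithms to base 2) -/

/-- Shannon entropy of a discrete distribution; it may be infinite. -/
def entropy {α : Type*} (p : PMF α) : ℝ≥0∞ :=
  ∑' a, ENNReal.ofReal (Real.negMulLog (p a).toReal / Real.log 2)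

/-- `H(A | B) = ∑ p(a, b) log (p(b) / p(a, b))` for a joint law `p` of `(A, B)`. -/
def condEntropy {α β : Type*} [Fintype α] [Fintype β] (p : PMF (α × β)) : ℝ :=
  ∑ a, ∑ b, (p (a, b)).toReal * Real.logb 2 ((p.map Prod.snd b).toReal / (p (a, b)).toReal)

/-- `I(A ; B) = ∑ p(a, b) log (p(a, b) / (p(a) p(b)))` for a joint law `p` of `(A, B)`. -/
def mutualInfo {α β : Type*} [Fintype α] [Fintype β] (p : PMF (α × β)) : ℝ :=
  ∑ a, ∑ b, (p (a, b)).toReal *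
    Real.logb 2 ((p (a, b)).toReal / ((p.map Prod.fst a).toReal * (p.map Prod.snd b).toReal))

/-- Gács–Körner common information: the largest entropy of a random variable `Q` that is almost
surely equal both to a function of `A` and to a function of `B`.  The values of `Q` are labelled by
natural numbers. -/
def commonInfo {α β : Type*} (p : PMF (α × β)) : ℝ≥0∞ :=
  ⨆ (f : α → ℕ) (g : β → ℕ) (_ : ∀ a b, p (a, b) ≠ 0 → f a = g b),
    entropy (p.map fun ab => f ab.1)

/-- Residual information `RI(A ; B) = I(A ; B) - H(A ⊓ B)`. -/
def residualInfo {α β : Type*} [Fintype α] [Fintype β] (p : PMF (α × β)) : ℝ :=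
  mutualInfo p - (commonInfo p).toReal

/-- The Markov chain `T - U - V`: `T` and `V` are conditionally independent given `U`. -/
def IsMarkovChain {Ω α β γ : Type*} (p : PMF Ω) (T : Ω → α) (U : Ω → β) (V : Ω → γ) : Prop :=
  ∀ t u v,
    p.map (fun ω => (T ω, U ω, V ω)) (t, u, v) * p.map U u =
      p.map (fun ω => (T ω, U ω)) (t, u) * p.map (fun ω => (U ω, V ω)) (u, v)

/-! ### The functionality -/

/-- The product distribution `p_X p_Y`. -/
def prodLaw {α β : Type*} (pX : PMF α) (pY : PMF β) : PMF (α × β) :=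
  pX.bind fun x => pY.map fun y => (x, y)

/-- The joint distribution `p_{XYZ} = p_{XY} p_{Z|XY}`. -/
def targetLaw {𝒳 𝒴 𝒵 : Type*} (pXY : PMF (𝒳 × 𝒴)) (W : 𝒳 → 𝒴 → PMF 𝒵) : PMF (𝒳 × 𝒴 × 𝒵) :=
  pXY.bind fun xy => (W xy.1 xy.2).map fun z => (xy.1, xy.2, z)

/-- `p_{Z|XY}` is in normal form: there are no two distinct equivalent inputs of Alice, inputs of
Bob, or outputs of Charlie. -/
structure NormalForm {𝒳 𝒴 𝒵 : Type*} (W : 𝒳 → 𝒴 → PMF 𝒵) : Prop where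
  left : ∀ x x', (∀ y z, W x y z = W x' y z) → x = x'
  right : ∀ y y', (∀ x z, W x y z = W x y' z) → y = y'
  output : ∀ z z', (∃ c : ℝ, ∀ x y, (W x y z).toReal = c * (W x y z').toReal) → z = z'

/-! ### Protocols -/

/-- A pair of bit strings on a link, one for each direction.  The first component is the one in the
direction `1 → 2`, `2 → 3` or `3 → 1`. -/
abbrev LinkMsg := List Bool × List Bool

/-- The messages exchanged on one link, round by round, in chronological order. -/
abbrev LinkHist := List LinkMsg

/-- The messages sent in one round; `mij` is sent by party `i` to party `j`. -/
@[ext] structure Round where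
  m12 : List Bool
  m21 : List Bool
  m23 : List Bool
  m32 : List Bool
  m31 : List Bool
  m13 : List Bool

/-- The round in which all messages are empty. -/
def Round.silent : Round := ⟨[], [], [], [], [], []⟩

/-- A state: the inputs of Alice and Bob, and the messages exchanged so far, round by round. -/
@[ext] structure State (𝒳 𝒴 : Type*) where
  x : 𝒳
  y : 𝒴
  rounds : List Round

namespace State

variable {𝒳 𝒴 : Type*}

/-- The state after one more round. -/
def append (s : State 𝒳 𝒴) (r : Round) : State 𝒳 𝒴 := ⟨s.x, s.y, s.rounds ++ [r]⟩

/-- The state after `k` further rounds in which nothing is sent. -/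
def wait (s : State 𝒳 𝒴) (k : ℕ) : State 𝒳 𝒴 :=
  ⟨s.x, s.y, s.rounds ++ List.replicate k Round.silent⟩

def link12 (s : State 𝒳 𝒴) : LinkHist := s.rounds.map fun r => (r.m12, r.m21)

def link23 (s : State 𝒳 𝒴) : LinkHist := s.rounds.map fun r => (r.m23, r.m32)

def link31 (s : State 𝒳 𝒴) : LinkHist := s.rounds.map fun r => (r.m31, r.m13)

end State

/-- The transcript of a link: in each direction the concatenation of all bits sent. -/
def LinkHist.transcript (h : LinkHist) : LinkMsg :=
  ((h.map Prod.fst).flatten, (h.map Prod.snd).flatten)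

/-- A protocol for Alice (party 1, input in `𝒳`), Bob (party 2, input in `𝒴`) and Charlie (party 3,
no input, output in `𝒵`).  In every round each party sends one (possibly empty) bit string on each
of its two links; the distribution of this pair depends on the party's input and on the messages
on its two links in the previous rounds.  Charlie's output is a randomized function of the final
transcripts of his two links. -/
structure Protocol (𝒳 𝒴 𝒵 : Type*) where
  /-- From Alice's input and the histories of links 12 and 31: messages to Bob and to Charlie. -/
  alice : 𝒳 → LinkHist → LinkHist → PMF (List Bool × List Bool)
  /-- From Bob's input and the histories of links 12 and 23: messages to Alice and to Charlie. -/
  bob : 𝒴 → LinkHist → LinkHist → PMF (List Bool × List Bool)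
  /-- From the histories of links 23 and 31: messages to Alice and to Bob. -/
  charlie : LinkHist → LinkHist → PMF (List Bool × List Bool)
  /-- From the final transcripts of links 23 and 31: Charlie's output. -/
  output : LinkMsg → LinkMsg → PMF 𝒵

/-- The inputs and the final transcripts on the three links. -/
@[ext] structure Final (𝒳 𝒴 : Type*) where
  x : 𝒳
  y : 𝒴
  m12 : LinkMsg
  m23 : LinkMsg
  m31 : LinkMsg

def State.final {𝒳 𝒴 : Type*} (s : State 𝒳 𝒴) : Final 𝒳 𝒴 :=
  ⟨s.x, s.y, s.link12.transcript, s.link23.transcript, s.link31.transcript⟩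

/-- The inputs, the final transcripts on the three links, and Charlie's output. -/
structure Outcome (𝒳 𝒴 𝒵 : Type*) where
  x : 𝒳
  y : 𝒴
  z : 𝒵
  m12 : LinkMsg
  m23 : LinkMsg
  m31 : LinkMsg

namespace Outcome

variable {𝒳 𝒴 𝒵 : Type*}

/-- `M₁ = (M₁₂, M₃₁)`, the transcripts that Alice sees. -/
def m1 (o : Outcome 𝒳 𝒴 𝒵) : LinkMsg × LinkMsg := (o.m12, o.m31)

/-- `M₂ = (M₁₂, M₂₃)`, the transcripts that Bob sees. -/
def m2 (o : Outcome 𝒳 𝒴 𝒵) : LinkMsg × LinkMsg := (o.m12, o.m23)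

/-- `M₃ = (M₂₃, M₃₁)`, the transcripts that Charlie sees. -/
def m3 (o : Outcome 𝒳 𝒴 𝒵) : LinkMsg × LinkMsg := (o.m23, o.m31)

end Outcome

/-- No code word is a proper prefix of another one. -/
def PrefixFree (C : Set (List Bool)) : Prop :=
  ∀ u ∈ C, ∀ v ∈ C, u <+: v → u = v

namespace Protocol

variable {𝒳 𝒴 𝒵 : Type*} (P : Protocol 𝒳 𝒴 𝒵) (pXY : PMF (𝒳 × 𝒴))

/-- The law of the messages of the next round: given the state, the three parties choose their
messages independently. -/
def roundLaw (s : State 𝒳 𝒴) : PMF Round :=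
  (P.alice s.x s.link12 s.link31).bind fun a =>
    (P.bob s.y s.link12 s.link23).bind fun b =>
      (P.charlie s.link23 s.link31).map fun c =>
        { m12 := a.1, m13 := a.2, m21 := b.1, m23 := b.2, m31 := c.1, m32 := c.2 }

/-- The law of the state after `n` rounds. -/
def stateLaw : ℕ → PMF (State 𝒳 𝒴)
  | 0 => pXY.map fun xy => ⟨xy.1, xy.2, []⟩
  | n + 1 => (stateLaw n).bind fun s => (P.roundLaw s).map fun r => s.append r

/-- In the state `s`, and in all rounds to come, all parties send nothing but empty strings. -/
def Terminated (s : State 𝒳 𝒴) : Prop :=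
  ∀ k, P.roundLaw (s.wait k) = PMF.pure Round.silent

/-- With probability 1 the protocol reaches a state in which it has terminated. -/
def Terminates : Prop :=
  Filter.Tendsto (fun n => (P.stateLaw pXY n).toOuterMeasure {s | P.Terminated s})
    Filter.atTop (nhds 1)

/-- In every round, the message on each directed link is a code word of a prefix-free code that is
determined by the messages exchanged on that link, in both directions, in the previous rounds. -/
def UsesPrefixFreeCodes : Prop :=
  ∃ C12 C21 C23 C32 C31 C13 : LinkHist → Set (List Bool),
    (∀ h, PrefixFree (C12 h) ∧ PrefixFree (C21 h) ∧ PrefixFree (C23 h) ∧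
      PrefixFree (C32 h) ∧ PrefixFree (C31 h) ∧ PrefixFree (C13 h)) ∧
    ∀ n, ∀ s ∈ (P.stateLaw pXY n).support, ∀ r ∈ (P.roundLaw s).support,
      r.m12 ∈ C12 s.link12 ∧ r.m21 ∈ C21 s.link12 ∧
      r.m23 ∈ C23 s.link23 ∧ r.m32 ∈ C32 s.link23 ∧
      r.m31 ∈ C31 s.link31 ∧ r.m13 ∈ C13 s.link31

/-- The probability that after `n` rounds the protocol has terminated with inputs and final
transcripts `e`. -/
def finalMassAt (n : ℕ) (e : Final 𝒳 𝒴) : ℝ≥0∞ :=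
  (P.stateLaw pXY n).toOuterMeasure {s | P.Terminated s ∧ s.final = e}

variable {P} in
theorem Terminated.append_silent {s : State 𝒳 𝒴} (h : P.Terminated s) :
    P.Terminated (s.append Round.silent) := by
  intro k
  have := h (k + 1)
  simpa [State.wait, State.append, List.replicate_succ] using this

theorem _root_.ThreeParty.State.final_append_silent (s : State 𝒳 𝒴) :
    (s.append Round.silent).final = s.final := by
  simp [State.final, State.append, State.link12, State.link23, State.link31,
    LinkHist.transcript, Round.silent]

theorem finalMassAt_mono (e : Final 𝒳 𝒴) : Monotone fun n => P.finalMassAt pXY n e := by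
  refine monotone_nat_of_le_succ fun n => ?_
  unfold finalMassAt
  rw [stateLaw, PMF.toOuterMeasure_bind_apply, PMF.toOuterMeasure_apply]
  refine ENNReal.tsum_le_tsum fun s => ?_
  by_cases hs : s ∈ {s | P.Terminated s ∧ s.final = e}
  · rw [Set.indicator_of_mem hs]
    have h0 : P.roundLaw s = PMF.pure Round.silent := by
      simpa [State.wait] using hs.1 0
    have h1 : s.append Round.silent ∈ {s | P.Terminated s ∧ s.final = e} :=
      ⟨hs.1.append_silent, by rw [State.final_append_silent]; exact hs.2⟩
    rw [h0, PMF.pure_map, PMF.toOuterMeasure_pure_apply, if_pos h1, mul_one]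
  · rw [Set.indicator_of_notMem hs]
    exact zero_le

theorem tsum_finalMassAt (n : ℕ) :
    ∑' e, P.finalMassAt pXY n e = (P.stateLaw pXY n).toOuterMeasure {s | P.Terminated s} := by
  classical
  simp only [finalMassAt, PMF.toOuterMeasure_apply]
  rw [ENNReal.tsum_comm]
  refine tsum_congr fun s => ?_
  rw [tsum_eq_single s.final]
  · simp [Set.indicator_apply]
  · intro e he
    rw [Set.indicator_of_notMem]
    exact fun h => he h.2.symm

theorem tsum_iSup_finalMassAt (h : P.Terminates pXY) :
    ∑' e, ⨆ n, P.finalMassAt pXY n e = 1 := by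
  have hmono : Monotone fun n => ∑' e, P.finalMassAt pXY n e := fun m n hmn =>
    ENNReal.tsum_le_tsum fun e => P.finalMassAt_mono pXY e hmn
  have h1 : ∑' e, ⨆ n, P.finalMassAt pXY n e = ⨆ n, ∑' e, P.finalMassAt pXY n e := by
    simp only [ENNReal.tsum_eq_iSup_sum]
    rw [iSup_comm]
    refine iSup_congr fun t => ?_
    exact ENNReal.finsetSum_iSup_of_monotone fun e => P.finalMassAt_mono pXY e
  rw [h1]
  refine tendsto_nhds_unique (tendsto_atTop_iSup hmono) ?_
  unfold Terminates at h
  simpa only [tsum_finalMassAt] using h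

/-- The joint law of the inputs and the final transcripts. -/
def finalLaw (h : P.Terminates pXY) : PMF (Final 𝒳 𝒴) :=
  ⟨fun e => ⨆ n, P.finalMassAt pXY n e,
    (P.tsum_iSup_finalMassAt pXY h) ▸ ENNReal.summable.hasSum⟩

/-- The joint law of the inputs, the final transcripts and Charlie's output. -/
def outcomeLaw (h : P.Terminates pXY) : PMF (Outcome 𝒳 𝒴 𝒵) :=
  (P.finalLaw pXY h).bind fun e =>
    (P.output e.m23 e.m31).map fun z => ⟨e.x, e.y, z, e.m12, e.m23, e.m31⟩

/-- `P` is a well-formed and perfectly secure protocol for `(p_{XY}, p_{Z|XY})`: it is correct, and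
private against each single, passively corrupt party. -/
structure IsSecure (W : 𝒳 → 𝒴 → PMF 𝒵) : Prop where
  prefixFree : P.UsesPrefixFreeCodes pXY
  terminates : P.Terminates pXY
  correct : (P.outcomeLaw pXY terminates).map (fun o => (o.x, o.y, o.z)) = targetLaw pXY W
  private_alice : IsMarkovChain (P.outcomeLaw pXY terminates)
    Outcome.m1 Outcome.x (fun o => (o.y, o.z))
  private_bob : IsMarkovChain (P.outcomeLaw pXY terminates)
    Outcome.m2 Outcome.y (fun o => (o.x, o.z))
  private_charlie : IsMarkovChain (P.outcomeLaw pXY terminates)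
    Outcome.m3 Outcome.z (fun o => (o.x, o.y))

end Protocol

end ThreeParty

end

/-! Write A, B, C for the transcripts M₁₂, M₂₃, M₃₁.

Structure. After any number of rounds the law of the inputs and the link histories factors as a(x,
A, C) · b(y, A, B) · c(B, C) when the inputs are independent, because each party acts only on what
it sees (`exists_viewLaw_eq_mul`). Hence X - M₁ - (Y, Z) and Y - M₂ - (X, Z); also Z - M₃ - (X, Y)
by the form of the output. Privacy gives the reversed chains M₁ - X - (Y, Z) and so on, and two
opposite chains force p(y, z | x) = p(y, z | m₁) (`double_markov`). Inputs compatible with the same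
m₁ are therefore equivalent, hence equal by normal form and full support. So almost surely (A, C)
determines X, (A, B) determines Y and (B, C) determines Z.

Residual information. From C - X - Z and C - Z - X, the conditional law of C is the same given x as
given z, so it is a common function of X and Z and carries all dependence on C. Thus I(X; C) and
I(Z; C) are at most the common information of X and Z (`ent_le_condEnt_add_commonInfo`), and
likewise for B, Y and Z.

Links of Charlie. H(B) ≥ H(B | C) = H(Z | C) + H(B | Z, C). The first term is at least H(Z) minus
the common information. The second is at least H(Y | Z, X, A, C), since Y is recovered from A and B;
by Alice's privacy this is H(Y | Z, X). Exchanging Alice and Bob gives the bound for C.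

Link of Alice and Bob. For independent inputs I(A; B) ≥ I(A; B | C). This holds for empty histories
and survives the messages of each party (`nonnegInteraction_viewLaw`). It says H(A) ≥ I(A; B | C) +
I(A; C | B) + H(A | B, C). By data processing the three terms are at least I(X; B | C), I(Y; C | B)
and H(X, Y | B, C). Charlie's privacy replaces conditioning on (B, C) by conditioning on Z, and the
common-information bound turns H(X | C) and H(Y | B) into residual information.

Unbounded running time. The factorization and the induction concern a fixed number n of rounds,
while the theorem concerns final transcripts, whose entropy may be infinite. Prefix-freeness makes
the history of n rounds a function of the final transcript of the link (`viewAt`, `map_viewAt`), so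
all rounds live on one probability space. Markov chains and conditional entropies of the finite
variables X and Y then pass to the limit n → ∞. -/

open scoped ENNReal

noncomputable section

namespace ThreeParty

/-! ### Conditional entropy of random variables on a discrete probability space -/

section Entropy

variable {Ω α β γ δ : Type*}

/-- The pair of two random variables. -/
abbrev joint (X : Ω → α) (Y : Ω → β) : Ω → α × β := fun ω => (X ω, Y ω)

/-- The probability that `X` takes the value that it has at `ω`. -/
def fiberProb (μ : PMF Ω) (X : Ω → α) (ω : Ω) : ℝ := (μ.map X (X ω)).toReal

/-- The conditional entropy `H(X | Y)` in bits; it may be infinite. -/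
def condEnt (μ : PMF Ω) (X : Ω → α) (Y : Ω → β) : ℝ≥0∞ :=
  ∑' ω, μ ω * ENNReal.ofReal (Real.logb 2 (fiberProb μ Y ω / fiberProb μ (joint X Y) ω))

/-- The entropy `H(X)` in bits; it may be infinite. -/
abbrev ent (μ : PMF Ω) (X : Ω → α) : ℝ≥0∞ := condEnt μ X fun _ => ()

theorem map_apply_eq [DecidableEq α] (μ : PMF Ω) (X : Ω → α) (a : α) :
    μ.map X a = ∑' ω, if X ω = a then μ ω else 0 := by
  rw [PMF.map_apply]
  refine tsum_congr fun ω => ?_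
  by_cases h : X ω = a
  · rw [if_pos h, if_pos h.symm]
  · rw [if_neg h, if_neg (Ne.symm h)]

theorem tsum_map_mul (μ : PMF Ω) (X : Ω → α) (g : α → ℝ≥0∞) :
    ∑' a, μ.map X a * g a = ∑' ω, μ ω * g (X ω) := by
  classical
  simp only [map_apply_eq, ← ENNReal.tsum_mul_right]
  rw [ENNReal.tsum_comm]
  refine tsum_congr fun ω => ?_
  rw [tsum_eq_single (X ω)]
  · simp
  · intro a ha
    rw [if_neg (Ne.symm ha), zero_mul]

theorem tsum_map_pair_left (μ : PMF Ω) (X : Ω → α) (Y : Ω → β) (y : β) :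
    ∑' x, μ.map (joint X Y) (x, y) = μ.map Y y := by
  classical
  simp only [map_apply_eq]
  rw [ENNReal.tsum_comm]
  refine tsum_congr fun ω => ?_
  rw [tsum_eq_single (X ω)]
  · simp
  · intro a ha
    rw [if_neg]
    simp [Ne.symm ha]

theorem tsum_map_pair_right (μ : PMF Ω) (X : Ω → α) (Y : Ω → β) (x : α) :
    ∑' y, μ.map (joint X Y) (x, y) = μ.map X x := by
  classical
  simp only [map_apply_eq]
  rw [ENNReal.tsum_comm]
  refine tsum_congr fun ω => ?_
  rw [tsum_eq_single (Y ω)]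
  · simp
  · intro a ha
    rw [if_neg]
    simp [Ne.symm ha]

theorem map_apply_ne_top (μ : PMF Ω) (X : Ω → α) (a : α) : μ.map X a ≠ ∞ :=
  PMF.apply_ne_top _ _

theorem map_apply_ne_zero {μ : PMF Ω} {ω : Ω} (hω : μ ω ≠ 0) (X : Ω → α) : μ.map X (X ω) ≠ 0 := by
  rw [← PMF.mem_support_iff, PMF.support_map]
  exact ⟨ω, hω, rfl⟩

theorem fiberProb_pos {μ : PMF Ω} {ω : Ω} (hω : μ ω ≠ 0) (X : Ω → α) : 0 < fiberProb μ X ω :=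
  ENNReal.toReal_pos (map_apply_ne_zero hω X) (map_apply_ne_top _ _ _)

theorem fiberProb_le_of_det {μ : PMF Ω} {X : Ω → α} {Y : Ω → β} {ω : Ω}
    (h : ∀ ω', μ ω' ≠ 0 → X ω' = X ω → Y ω' = Y ω) : fiberProb μ X ω ≤ fiberProb μ Y ω := by
  classical
  refine ENNReal.toReal_mono (map_apply_ne_top _ _ _) ?_
  rw [map_apply_eq, map_apply_eq]
  refine ENNReal.tsum_le_tsum fun ω' => ?_
  by_cases h0 : μ ω' = 0
  · simp [h0]
  · by_cases h1 : X ω' = X ω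
    · rw [if_pos h1, if_pos (h ω' h0 h1)]
    · rw [if_neg h1]
      exact zero_le

theorem fiberProb_congr {μ : PMF Ω} {X : Ω → α} {Y : Ω → β} {ω : Ω}
    (h : ∀ ω', μ ω' ≠ 0 → (X ω' = X ω ↔ Y ω' = Y ω)) : fiberProb μ X ω = fiberProb μ Y ω :=
  le_antisymm (fiberProb_le_of_det fun ω' h0 => (h ω' h0).1)
    (fiberProb_le_of_det fun ω' h0 => (h ω' h0).2)

theorem fiberProb_map (μ : PMF Ω) (f : Ω → α) (X : α → β) (ω : Ω) :
    fiberProb (μ.map f) X (f ω) = fiberProb μ (fun ω => X (f ω)) ω := by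
  rw [fiberProb, PMF.map_comp]; rfl

theorem fiberProb_const (μ : PMF Ω) (c : α) (ω : Ω) : fiberProb μ (fun _ => c) ω = 1 := by
  have : μ.map (fun _ => c) = PMF.pure c := PMF.map_const μ c
  simp [fiberProb, this]

theorem tsum_mul_congr {μ : PMF Ω} {f g : Ω → ℝ≥0∞} (h : ∀ ω, μ ω ≠ 0 → f ω = g ω) :
    ∑' ω, μ ω * f ω = ∑' ω, μ ω * g ω := by
  refine tsum_congr fun ω => ?_
  by_cases h0 : μ ω = 0
  · simp [h0]
  · rw [h ω h0]

theorem tsum_mul_mono {μ : PMF Ω} {f g : Ω → ℝ≥0∞} (h : ∀ ω, μ ω ≠ 0 → f ω ≤ g ω) :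
    ∑' ω, μ ω * f ω ≤ ∑' ω, μ ω * g ω := by
  refine ENNReal.tsum_le_tsum fun ω => ?_
  by_cases h0 : μ ω = 0
  · simp [h0]
  · exact mul_le_mul' le_rfl (h ω h0)

/-- Conditional entropy sees only the partitions that the variables induce on the support. This is
what allows a history to be traded for its transcript. -/
theorem condEnt_congr {α' β' : Type*} {μ : PMF Ω} {X : Ω → α} {Y : Ω → β} {X' : Ω → α'}
    {Y' : Ω → β'} (hY : ∀ ω ω', μ ω ≠ 0 → μ ω' ≠ 0 → (Y ω' = Y ω ↔ Y' ω' = Y' ω))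
    (hXY : ∀ ω ω', μ ω ≠ 0 → μ ω' ≠ 0 →
      (X ω' = X ω ∧ Y ω' = Y ω ↔ X' ω' = X' ω ∧ Y' ω' = Y' ω)) :
    condEnt μ X Y = condEnt μ X' Y' := by
  refine tsum_mul_congr fun ω hω => ?_
  rw [fiberProb_congr fun ω' h => hY ω ω' hω h,
    fiberProb_congr (X := joint X Y) (Y := joint X' Y') fun ω' h => by
      simpa only [Prod.mk.injEq] using hXY ω ω' hω h]

theorem condEnt_map (μ : PMF Ω) (f : Ω → α) (X : α → β) (Y : α → γ) :
    condEnt (μ.map f) X Y = condEnt μ (fun ω => X (f ω)) (fun ω => Y (f ω)) := by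
  rw [condEnt, tsum_map_mul]
  simp only [fiberProb_map]
  rfl

theorem logb_fiberProb_nonneg {μ : PMF Ω} {ω : Ω} (hω : μ ω ≠ 0) {X : Ω → α} {Y : Ω → β}
    (h : ∀ ω', μ ω' ≠ 0 → X ω' = X ω → Y ω' = Y ω) :
    0 ≤ Real.logb 2 (fiberProb μ Y ω / fiberProb μ X ω) :=
  Real.logb_nonneg one_lt_two
    ((one_le_div (fiberProb_pos hω X)).2 (fiberProb_le_of_det h))

theorem logb_joint_nonneg {μ : PMF Ω} {ω : Ω} (hω : μ ω ≠ 0) (X : Ω → α) (Y : Ω → β) :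
    0 ≤ Real.logb 2 (fiberProb μ Y ω / fiberProb μ (joint X Y) ω) :=
  logb_fiberProb_nonneg hω fun _ _ h => (Prod.ext_iff.1 h).2

/-- The chain rule `H(X, Y | Z) = H(X | Z) + H(Y | X, Z)`. -/
theorem condEnt_chain (μ : PMF Ω) (X : Ω → α) (Y : Ω → β) (Z : Ω → γ) :
    condEnt μ (joint X Y) Z = condEnt μ X Z + condEnt μ Y (joint X Z) := by
  rw [condEnt, condEnt, condEnt, ← ENNReal.tsum_add]
  simp only [← mul_add]
  refine tsum_mul_congr fun ω hω => ?_
  rw [← ENNReal.ofReal_add (logb_joint_nonneg hω _ _) (logb_joint_nonneg hω _ _)]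
  have e : fiberProb μ (joint Y (joint X Z)) ω = fiberProb μ (joint (joint X Y) Z) ω :=
    fiberProb_congr fun ω' _ => by simp only [Prod.mk.injEq]; tauto
  have h1 := fiberProb_pos hω Z
  have h2 := fiberProb_pos hω (joint X Z)
  have h3 := fiberProb_pos hω (joint (joint X Y) Z)
  rw [e, ← Real.logb_mul (by positivity) (by positivity)]
  congr 2
  field_simp

/-- Two nonnegative quantities whose difference is the pointwise conditional mutual information
of `X` and `Y` given `Z` have ordered expectations. -/
theorem tsum_logb_le_of_ratio (μ : PMF Ω) (X : Ω → α) (Y : Ω → β) (Z : Ω → γ) (U V : Ω → ℝ)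
    (hU : ∀ ω, μ ω ≠ 0 → 0 ≤ U ω) (hV : ∀ ω, μ ω ≠ 0 → 0 ≤ V ω)
    (h : ∀ ω, μ ω ≠ 0 → U ω = V ω + Real.logb 2
      (fiberProb μ (joint Y Z) ω * fiberProb μ (joint X Z) ω /
        (fiberProb μ Z ω * fiberProb μ (joint X (joint Y Z)) ω))) :
    ∑' ω, μ ω * ENNReal.ofReal (U ω) ≤ ∑' ω, μ ω * ENNReal.ofReal (V ω) := by
  -- Gibbs' inequality without subtraction, so that infinite expectations are allowed. With r the
  -- ratio in `h`, log₂ r ≤ c (r - 1) gives U + c ≤ V + c r pointwise; the expectation of r is at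
  -- most 1, and the finite c cancels.
  set c : ℝ≥0∞ := ENNReal.ofReal (Real.log 2)⁻¹ with hc
  have hc' : 0 < (Real.log 2)⁻¹ := inv_pos.2 (Real.log_pos one_lt_two)
  set F : α × β × γ → ℝ≥0∞ := fun w =>
    μ.map (joint Y Z) w.2 * μ.map (joint X Z) (w.1, w.2.2) / μ.map Z w.2.2 with hF
  set t : Ω → ℝ≥0∞ := fun ω =>
    F (X ω, Y ω, Z ω) / μ.map (joint X (joint Y Z)) (X ω, Y ω, Z ω) with ht
  -- `F` is the law under which X and Y are conditionally independent given Z with their true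
  -- conditional marginals. Only an inequality is needed, so values z of probability 0 require no
  -- care.
  have hFsum : ∑' w, F w ≤ 1 := by
    calc ∑' w, F w = ∑' z, ∑' y, ∑' x, F (x, y, z) := by
          rw [ENNReal.tsum_prod', ENNReal.tsum_comm, ENNReal.tsum_prod', ENNReal.tsum_comm]
      _ = ∑' z, (μ.map Z z * μ.map Z z) / μ.map Z z := by
          refine tsum_congr fun z => ?_
          simp only [hF, div_eq_mul_inv, ENNReal.tsum_mul_right, ENNReal.tsum_mul_left,
            tsum_map_pair_left]
      _ ≤ ∑' z, μ.map Z z := by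
          refine ENNReal.tsum_le_tsum fun z => ?_
          rw [mul_div_assoc]
          calc _ ≤ μ.map Z z * 1 := mul_le_mul' le_rfl ENNReal.div_self_le_one
            _ = _ := mul_one _
      _ = 1 := PMF.tsum_coe _
  have hEt : ∑' ω, μ ω * t ω ≤ 1 := by
    refine le_trans ?_ hFsum
    rw [← tsum_map_mul μ (joint X (joint Y Z)) fun w => F w / μ.map (joint X (joint Y Z)) w]
    exact ENNReal.tsum_le_tsum fun w => ENNReal.mul_div_le
  have htt : ∀ ω, μ ω ≠ 0 → t ω = ENNReal.ofReal
      (fiberProb μ (joint Y Z) ω * fiberProb μ (joint X Z) ω /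
        (fiberProb μ Z ω * fiberProb μ (joint X (joint Y Z)) ω)) := by
    intro ω hω
    have hz := fiberProb_pos hω Z
    have hxyz := fiberProb_pos hω (joint X (joint Y Z))
    have e1 : μ.map (joint Y Z) (Y ω, Z ω) = ENNReal.ofReal (fiberProb μ (joint Y Z) ω) :=
      (ENNReal.ofReal_toReal (map_apply_ne_top _ _ _)).symm
    have e2 : μ.map (joint X Z) (X ω, Z ω) = ENNReal.ofReal (fiberProb μ (joint X Z) ω) :=
      (ENNReal.ofReal_toReal (map_apply_ne_top _ _ _)).symm
    have e3 : μ.map Z (Z ω) = ENNReal.ofReal (fiberProb μ Z ω) :=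
      (ENNReal.ofReal_toReal (map_apply_ne_top _ _ _)).symm
    have e4 : μ.map (joint X (joint Y Z)) (X ω, Y ω, Z ω) =
        ENNReal.ofReal (fiberProb μ (joint X (joint Y Z)) ω) :=
      (ENNReal.ofReal_toReal (map_apply_ne_top _ _ _)).symm
    simp only [ht, hF]
    rw [e1, e2, e3, e4, ← ENNReal.ofReal_mul (fiberProb_pos hω _).le,
      ← ENNReal.ofReal_div_of_pos hz, ← ENNReal.ofReal_div_of_pos hxyz, div_div]
  have key : ∑' ω, μ ω * (ENNReal.ofReal (U ω) + c) ≤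
      ∑' ω, μ ω * (ENNReal.ofReal (V ω) + c * t ω) := by
    refine tsum_mul_mono fun ω hω => ?_
    rw [htt ω hω, hc, ← ENNReal.ofReal_mul hc'.le]
    have hh := h ω hω
    set r := fiberProb μ (joint Y Z) ω * fiberProb μ (joint X Z) ω /
        (fiberProb μ Z ω * fiberProb μ (joint X (joint Y Z)) ω) with hr
    have hrpos : 0 < r := by
      have h1 := fiberProb_pos hω (joint Y Z)
      have h2 := fiberProb_pos hω (joint X Z)
      have h3 := fiberProb_pos hω Z
      have h4 := fiberProb_pos hω (joint X (joint Y Z))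
      positivity
    rw [← ENNReal.ofReal_add (hV ω hω) (by positivity), ← ENNReal.ofReal_add (hU ω hω) hc'.le]
    have hlog : Real.logb 2 r ≤ (Real.log 2)⁻¹ * r - (Real.log 2)⁻¹ := by
      rw [Real.logb, div_eq_inv_mul, ← mul_sub_one]
      exact mul_le_mul_of_nonneg_left (Real.log_le_sub_one_of_pos hrpos) hc'.le
    refine ENNReal.ofReal_le_ofReal ?_
    linarith
  simp only [mul_add, ENNReal.tsum_add, ENNReal.tsum_mul_right, PMF.tsum_coe, one_mul,
    mul_left_comm _ c, ENNReal.tsum_mul_left] at key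
  have hctop : c ≠ ∞ := ENNReal.ofReal_ne_top
  refine (ENNReal.add_le_add_iff_right hctop).1 (key.trans ?_)
  gcongr
  calc c * ∑' ω, μ ω * t ω ≤ c * 1 := mul_le_mul' le_rfl hEt
    _ = c := mul_one c

/-- Conditioning reduces entropy: `H(X | Y, Z) ≤ H(X | Z)`. -/
theorem condEnt_le (μ : PMF Ω) (X : Ω → α) (Y : Ω → β) (Z : Ω → γ) :
    condEnt μ X (joint Y Z) ≤ condEnt μ X Z := by
  refine tsum_logb_le_of_ratio μ X Y Z _ _ (fun ω hω => logb_joint_nonneg hω _ _)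
    (fun ω hω => logb_joint_nonneg hω _ _) fun ω hω => ?_
  have h1 := fiberProb_pos hω (joint Y Z)
  have h2 := fiberProb_pos hω (joint X Z)
  have h3 := fiberProb_pos hω Z
  have h4 := fiberProb_pos hω (joint X (joint Y Z))
  rw [← Real.logb_mul (by positivity) (by positivity)]
  congr 1
  field_simp

theorem condEnt_le_of_det {μ : PMF Ω} (X : Ω → α) {Y : Ω → β} {Z : Ω → γ}
    (h : ∀ ω ω', μ ω ≠ 0 → μ ω' ≠ 0 → Y ω' = Y ω → Z ω' = Z ω) :
    condEnt μ X Y ≤ condEnt μ X Z := by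
  refine le_of_eq_of_le ?_ (condEnt_le μ X Y Z)
  refine condEnt_congr (fun ω ω' h1 h2 => ?_) fun ω ω' h1 h2 => ?_ <;>
  · have := h ω ω' h1 h2
    simp only [Prod.mk.injEq]
    tauto

theorem condEnt_mono_left {μ : PMF Ω} {X : Ω → α} {Y : Ω → β} {Z : Ω → γ}
    (h : ∀ ω ω', μ ω ≠ 0 → μ ω' ≠ 0 → X ω' = X ω → Z ω' = Z ω → Y ω' = Y ω) :
    condEnt μ Y Z ≤ condEnt μ X Z := by
  have e : condEnt μ X Z = condEnt μ (joint Y X) Z := by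
    refine condEnt_congr (fun ω ω' h1 h2 => Iff.rfl) fun ω ω' h1 h2 => ?_
    have := h ω ω' h1 h2
    simp only [Prod.mk.injEq]
    tauto
  rw [e, condEnt_chain]
  exact le_self_add

/-- The determination is required on the support only, since the transcripts determine inputs and
output only almost surely. -/
theorem condEnt_eq_zero_of_det {μ : PMF Ω} {X : Ω → α} {Z : Ω → γ}
    (h : ∀ ω ω', μ ω ≠ 0 → μ ω' ≠ 0 → Z ω' = Z ω → X ω' = X ω) : condEnt μ X Z = 0 := by
  rw [condEnt, ENNReal.tsum_eq_zero]
  intro ω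
  by_cases hω : μ ω = 0
  · simp [hω]
  · rw [fiberProb_congr (X := Z) (Y := joint X Z) fun ω' h' => by
      have := h ω ω' hω h'
      simp only [Prod.mk.injEq]
      tauto]
    simp [div_self (fiberProb_pos hω _).ne']

theorem condEnt_pair_of_det {μ : PMF Ω} {X : Ω → α} {Y : Ω → β} {Z : Ω → γ}
    (h : ∀ ω ω', μ ω ≠ 0 → μ ω' ≠ 0 → X ω' = X ω → Z ω' = Z ω → Y ω' = Y ω) :
    condEnt μ X Z = condEnt μ Y Z + condEnt μ X (joint Y Z) := by
  rw [← condEnt_chain]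
  refine condEnt_congr (fun ω ω' h1 h2 => Iff.rfl) fun ω ω' h1 h2 => ?_
  have := h ω ω' h1 h2
  simp only [Prod.mk.injEq]
  tauto

/-! ### Markov chains -/

theorem IsMarkovChain.fiberProb_mul {μ : PMF Ω} {T : Ω → α} {U : Ω → β} {V : Ω → γ}
    (h : IsMarkovChain μ T U V) (ω : Ω) :
    fiberProb μ (fun ω => (T ω, U ω, V ω)) ω * fiberProb μ U ω =
      fiberProb μ (joint T U) ω * fiberProb μ (joint U V) ω := by
  have := congrArg ENNReal.toReal (h (T ω) (U ω) (V ω))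
  rwa [ENNReal.toReal_mul, ENNReal.toReal_mul] at this

theorem IsMarkovChain.symm {μ : PMF Ω} {T : Ω → α} {U : Ω → β} {V : Ω → γ}
    (h : IsMarkovChain μ T U V) : IsMarkovChain μ V U T := by
  classical
  intro v u t
  have := h t u v
  have e1 : μ.map (fun ω => (V ω, U ω, T ω)) (v, u, t) =
      μ.map (fun ω => (T ω, U ω, V ω)) (t, u, v) := by
    rw [map_apply_eq, map_apply_eq]
    refine tsum_congr fun ω => if_congr ?_ rfl rfl
    simp only [Prod.mk.injEq]; tauto
  have e2 : μ.map (fun ω => (V ω, U ω)) (v, u) = μ.map (fun ω => (U ω, V ω)) (u, v) := by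
    rw [map_apply_eq, map_apply_eq]
    refine tsum_congr fun ω => if_congr ?_ rfl rfl
    simp only [Prod.mk.injEq]; tauto
  have e3 : μ.map (fun ω => (U ω, T ω)) (u, t) = μ.map (fun ω => (T ω, U ω)) (t, u) := by
    rw [map_apply_eq, map_apply_eq]
    refine tsum_congr fun ω => if_congr ?_ rfl rfl
    simp only [Prod.mk.injEq]; tauto
  rw [e1, e2, e3, this, mul_comm]

theorem IsMarkovChain.condEnt_eq {μ : PMF Ω} {T : Ω → α} {U : Ω → β} {V : Ω → γ}
    (h : IsMarkovChain μ T U V) : condEnt μ V (joint T U) = condEnt μ V U := by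
  refine tsum_mul_congr fun ω hω => ?_
  have h1 := fiberProb_pos hω (joint V (joint T U))
  have h2 := fiberProb_pos hω (joint V U)
  have h3 := h.fiberProb_mul ω
  rw [fiberProb_congr (X := fun ω => (T ω, U ω, V ω)) (Y := joint V (joint T U)) fun ω' _ => by
      simp only [Prod.mk.injEq]; tauto,
    fiberProb_congr (X := joint U V) (Y := joint V U) fun ω' _ => by
      simp only [Prod.mk.injEq]; tauto] at h3
  rw [(div_eq_div_iff h1.ne' h2.ne').2 (by rw [← h3, mul_comm])]

theorem IsMarkovChain.map_right {μ : PMF Ω} {T : Ω → α} {U : Ω → β} {V : Ω → γ}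
    (h : IsMarkovChain μ T U V) (g : γ → δ) : IsMarkovChain μ T U fun ω => g (V ω) := by
  classical
  intro t u v
  have e1 : μ.map (fun ω => (T ω, U ω, g (V ω))) (t, u, v) =
      ∑' c, (if g c = v then 1 else 0) * μ.map (fun ω => (T ω, U ω, V ω)) (t, u, c) := by
    simp only [map_apply_eq, ← ENNReal.tsum_mul_left]
    rw [ENNReal.tsum_comm]
    refine tsum_congr fun ω => ?_
    rw [tsum_eq_single (V ω)]
    · by_cases h1 : g (V ω) = v <;> simp [h1]
    · intro c hc
      simp [Ne.symm hc]
  have e2 : μ.map (fun ω => (U ω, g (V ω))) (u, v) =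
      ∑' c, (if g c = v then 1 else 0) * μ.map (fun ω => (U ω, V ω)) (u, c) := by
    simp only [map_apply_eq, ← ENNReal.tsum_mul_left]
    rw [ENNReal.tsum_comm]
    refine tsum_congr fun ω => ?_
    rw [tsum_eq_single (V ω)]
    · by_cases h1 : g (V ω) = v <;> simp [h1]
    · intro c hc
      simp [Ne.symm hc]
  rw [e1, e2, ← ENNReal.tsum_mul_right, ← ENNReal.tsum_mul_left]
  refine tsum_congr fun c => ?_
  rw [mul_assoc, h t u c, mul_left_comm]

theorem IsMarkovChain.map_left {μ : PMF Ω} {T : Ω → α} {U : Ω → β} {V : Ω → γ}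
    (h : IsMarkovChain μ T U V) (f : α → δ) : IsMarkovChain μ (fun ω => f (T ω)) U V :=
  (h.symm.map_right f).symm

/-- A Markov chain follows from the invariance of products of probabilities under swaps. -/
theorem isMarkovChain_of_swap {μ : PMF Ω} {T : Ω → α} {U : Ω → β} {V : Ω → γ}
    (h : ∀ t t' u v v', μ.map (fun ω => (T ω, U ω, V ω)) (t, u, v) *
        μ.map (fun ω => (T ω, U ω, V ω)) (t', u, v') =
      μ.map (fun ω => (T ω, U ω, V ω)) (t, u, v') *
        μ.map (fun ω => (T ω, U ω, V ω)) (t', u, v)) : IsMarkovChain μ T U V := by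
  classical
  intro t u v
  have e1 : μ.map (fun ω => (T ω, U ω)) (t, u) =
      ∑' v', μ.map (fun ω => (T ω, U ω, V ω)) (t, u, v') := by
    simp only [map_apply_eq]
    rw [ENNReal.tsum_comm]
    refine tsum_congr fun ω => ?_
    rw [tsum_eq_single (V ω)]
    · simp
    · intro c hc
      simp [Ne.symm hc]
  rw [e1, ← tsum_map_pair_left μ T (joint U V), ← tsum_map_pair_left μ T U,
    ← ENNReal.tsum_mul_left, ← ENNReal.tsum_mul_left]
  refine tsum_congr fun t' => ?_
  have e2 : μ.map (joint T U) (t', u) =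
      ∑' v', μ.map (fun ω => (T ω, U ω, V ω)) (t', u, v') := by
    simp only [map_apply_eq]
    rw [ENNReal.tsum_comm]
    refine tsum_congr fun ω => ?_
    rw [tsum_eq_single (V ω)]
    · simp
    · intro c hc
      simp [Ne.symm hc]
  rw [e2, ← ENNReal.tsum_mul_left, ← ENNReal.tsum_mul_right]
  exact tsum_congr fun v' => h t t' u v v'

/-- A Markov chain follows from a factorization of the joint law. -/
theorem isMarkovChain_of_factor {μ : PMF Ω} {T : Ω → α} {U : Ω → β} {V : Ω → γ}
    (e : α → β → γ → Ω) (he : ∀ ω, e (T ω) (U ω) (V ω) = ω)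
    (hT : ∀ t u v, T (e t u v) = t) (hU : ∀ t u v, U (e t u v) = u)
    (hV : ∀ t u v, V (e t u v) = v) (φ : α → β → ℝ≥0∞) (ψ : β → γ → ℝ≥0∞)
    (h : ∀ t u v, μ (e t u v) = φ t u * ψ u v) : IsMarkovChain μ T U V := by
  classical
  have key : ∀ t u v, μ.map (fun ω => (T ω, U ω, V ω)) (t, u, v) = φ t u * ψ u v := by
    intro t u v
    rw [map_apply_eq, tsum_eq_single (e t u v), hT, hU, hV, if_pos rfl, h]
    intro ω hω
    rw [if_neg]
    intro h1
    simp only [Prod.mk.injEq] at h1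
    obtain ⟨rfl, rfl, rfl⟩ := h1
    exact hω (he ω).symm
  refine isMarkovChain_of_swap fun t t' u v v' => ?_
  simp only [key]
  ring

/-- If `T - U - V` and `U - T - V` are Markov chains, then for possible values `t` and `u` of
`(T, U)` the conditional laws of `V` given `T = t` and given `U = u` agree. -/
theorem double_markov {μ : PMF Ω} {T : Ω → α} {U : Ω → β} {V : Ω → γ}
    (h : IsMarkovChain μ T U V) (h' : IsMarkovChain μ U T V) {ω : Ω} (hω : μ ω ≠ 0) (v : γ) :
    μ.map (joint U V) (U ω, v) * μ.map T (T ω) = μ.map (joint T V) (T ω, v) * μ.map U (U ω) := by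
  classical
  have e1 : μ.map (fun ω => (U ω, T ω, V ω)) (U ω, T ω, v) =
      μ.map (fun ω => (T ω, U ω, V ω)) (T ω, U ω, v) := by
    rw [map_apply_eq, map_apply_eq]
    refine tsum_congr fun ω => if_congr ?_ rfl rfl
    simp only [Prod.mk.injEq]; tauto
  have e2 : μ.map (fun ω => (U ω, T ω)) (U ω, T ω) = μ.map (joint T U) (T ω, U ω) := by
    rw [map_apply_eq, map_apply_eq]
    refine tsum_congr fun ω => if_congr ?_ rfl rfl
    simp only [Prod.mk.injEq]; tauto
  have h1 := h (T ω) (U ω) v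
  have h2 := h' (U ω) (T ω) v
  rw [e1, e2] at h2
  -- Both chains express p(t, u, v); equating them and cancelling p(t, u), which is positive at ω,
  -- leaves p(v | u) = p(v | t).
  refine (ENNReal.mul_right_inj (map_apply_ne_zero hω (joint T U)) (map_apply_ne_top _ _ _)).1 ?_
  calc _ = μ.map (joint T U) (T ω, U ω) * μ.map (joint U V) (U ω, v) * μ.map T (T ω) := by
        rw [mul_assoc]
    _ = μ.map (joint T U) (T ω, U ω) * μ.map (joint T V) (T ω, v) * μ.map U (U ω) := by
        rw [← h2, ← h1]; ring
    _ = _ := by rw [mul_assoc]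

end Entropy
end ThreeParty

namespace ThreeParty

section Inequalities

variable {Ω α β γ δ κ α' β' γ' : Type*}

/-! ### Finite alphabets -/

theorem tsum_mul_ofReal_of_fintype [Fintype Ω] (μ : PMF Ω) {g : Ω → ℝ}
    (hg : ∀ ω, μ ω ≠ 0 → 0 ≤ g ω) :
    ∑' ω, μ ω * ENNReal.ofReal (g ω) = ENNReal.ofReal (∑ ω, (μ ω).toReal * g ω) := by
  rw [tsum_fintype, ENNReal.ofReal_sum_of_nonneg]
  · refine Finset.sum_congr rfl fun ω _ => ?_
    rw [ENNReal.ofReal_mul ENNReal.toReal_nonneg, ENNReal.ofReal_toReal (PMF.apply_ne_top _ _)]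
  · intro ω _
    by_cases h : μ ω = 0
    · simp [h]
    · exact mul_nonneg ENNReal.toReal_nonneg (hg ω h)

theorem condEnt_of_fintype [Fintype Ω] (μ : PMF Ω) (X : Ω → α) (Y : Ω → β) :
    condEnt μ X Y = ENNReal.ofReal (∑ ω, (μ ω).toReal *
      Real.logb 2 (fiberProb μ Y ω / fiberProb μ (joint X Y) ω)) :=
  tsum_mul_ofReal_of_fintype μ fun _ hω => logb_joint_nonneg hω _ _

theorem sum_logb_nonneg [Fintype Ω] (μ : PMF Ω) (X : Ω → α) (Y : Ω → β) :
    0 ≤ ∑ ω, (μ ω).toReal * Real.logb 2 (fiberProb μ Y ω / fiberProb μ (joint X Y) ω) := by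
  refine Finset.sum_nonneg fun ω _ => ?_
  by_cases h : μ ω = 0
  · simp [h]
  · exact mul_nonneg ENNReal.toReal_nonneg (logb_joint_nonneg h _ _)

theorem toReal_condEnt_of_fintype [Fintype Ω] (μ : PMF Ω) (X : Ω → α) (Y : Ω → β) :
    (condEnt μ X Y).toReal = ∑ ω, (μ ω).toReal *
      Real.logb 2 (fiberProb μ Y ω / fiberProb μ (joint X Y) ω) := by
  rw [condEnt_of_fintype, ENNReal.toReal_ofReal (sum_logb_nonneg μ X Y)]

theorem fiberProb_eq_of_injective (μ : PMF Ω) {X : Ω → α} (hX : Function.Injective X) (ω : Ω) :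
    fiberProb μ X ω = (μ ω).toReal := by
  rw [fiberProb_congr (X := X) (Y := id) fun ω' _ => hX.eq_iff, fiberProb, PMF.map_id]
  rfl

/-- The underlying space may be infinite; transporting to the law of the variable reduces the
entropy to a finite sum. -/
theorem ent_ne_top [Fintype α] (μ : PMF Ω) (X : Ω → α) : ent μ X ≠ ∞ := by
  have h := condEnt_map μ X id fun _ => ()
  have h' : ent μ X = ent (μ.map X) id := h.symm
  rw [h', ent, condEnt_of_fintype]
  exact ENNReal.ofReal_ne_top

theorem condEnt_le_ent (μ : PMF Ω) (X : Ω → α) (Y : Ω → β) : condEnt μ X Y ≤ ent μ X :=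
  condEnt_le_of_det X fun _ _ _ _ _ => rfl

theorem condEnt_ne_top [Fintype α] (μ : PMF Ω) (X : Ω → α) (Y : Ω → β) : condEnt μ X Y ≠ ∞ :=
  ne_top_of_le_ne_top (ent_ne_top μ X) (condEnt_le_ent μ X Y)

theorem entropy_map (μ : PMF Ω) (X : Ω → α) : entropy (μ.map X) = ent μ X := by
  rw [ent, condEnt]
  have e : ∀ ω, Real.logb 2 (fiberProb μ (fun _ => ()) ω / fiberProb μ (joint X fun _ => ()) ω) =
      Real.logb 2 (1 / (μ.map X (X ω)).toReal) := by
    intro ω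
    rw [fiberProb_const, fiberProb_congr (X := joint X fun _ => ()) (Y := X) fun ω' _ => by
      simp, fiberProb]
  simp only [e]
  rw [← tsum_map_mul μ X fun a => ENNReal.ofReal (Real.logb 2 (1 / (μ.map X a).toReal)), entropy]
  refine tsum_congr fun a => ?_
  conv_rhs => rw [← ENNReal.ofReal_toReal (map_apply_ne_top μ X a)]
  rw [← ENNReal.ofReal_mul ENNReal.toReal_nonneg, ENNReal.toReal_ofReal ENNReal.toReal_nonneg]
  congr 1
  rw [Real.negMulLog, one_div, Real.logb_inv, Real.logb]
  ring

theorem toReal_condEnt [Fintype α] [Fintype β] (μ : PMF Ω) (X : Ω → α) (Y : Ω → β) :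
    (condEnt μ X Y).toReal = condEntropy (μ.map (joint X Y)) := by
  have h : condEnt μ X Y = condEnt (μ.map (joint X Y)) Prod.fst Prod.snd :=
    (condEnt_map μ (joint X Y) Prod.fst Prod.snd).symm
  rw [h, toReal_condEnt_of_fintype, condEntropy, Fintype.sum_prod_type]
  refine Finset.sum_congr rfl fun a _ => Finset.sum_congr rfl fun b _ => ?_
  rw [fiberProb_eq_of_injective (X := joint Prod.fst Prod.snd) _ fun _ _ h => h]
  rfl

theorem mutualInfo_eq_left [Fintype α] [Fintype β] (μ : PMF Ω) (X : Ω → α) (Y : Ω → β) :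
    mutualInfo (μ.map (joint X Y)) = (ent μ X).toReal - (condEnt μ X Y).toReal := by
  have h : condEnt μ X Y = condEnt (μ.map (joint X Y)) Prod.fst Prod.snd :=
    (condEnt_map μ (joint X Y) Prod.fst Prod.snd).symm
  have h' : ent μ X = ent (μ.map (joint X Y)) Prod.fst :=
    (condEnt_map μ (joint X Y) Prod.fst fun _ => ()).symm
  set p := μ.map (joint X Y)
  rw [h, h', ent, toReal_condEnt_of_fintype, toReal_condEnt_of_fintype, ← Finset.sum_sub_distrib,
    mutualInfo, Fintype.sum_prod_type]
  refine Finset.sum_congr rfl fun a _ => Finset.sum_congr rfl fun b _ => ?_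
  by_cases h0 : p (a, b) = 0
  · simp [h0]
  rw [fiberProb_const, fiberProb_eq_of_injective (X := joint Prod.fst Prod.snd) _ fun _ _ h => h,
    fiberProb_congr (X := joint Prod.fst fun _ => ()) (Y := Prod.fst) fun ω' _ => by simp,
    ← mul_sub]
  have h1 : 0 < (p (a, b)).toReal := ENNReal.toReal_pos h0 (PMF.apply_ne_top _ _)
  have h2 := fiberProb_pos h0 Prod.fst
  have h3 := fiberProb_pos h0 Prod.snd
  rw [← Real.logb_div (by positivity) (by positivity)]
  change _ = (p (a, b)).toReal * Real.logb 2
    (1 / (p.map Prod.fst a).toReal / ((p.map Prod.snd b).toReal / _))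
  congr 2
  change 0 < (p.map Prod.fst a).toReal at h2
  change 0 < (p.map Prod.snd b).toReal at h3
  field_simp

theorem mutualInfo_eq_right [Fintype α] [Fintype β] (μ : PMF Ω) (X : Ω → α) (Y : Ω → β) :
    mutualInfo (μ.map (joint X Y)) = (ent μ Y).toReal - (condEnt μ Y X).toReal := by
  have h1 : ent μ X + condEnt μ Y X = ent μ Y + condEnt μ X Y := by
    have e1 := condEnt_chain μ X Y fun _ => ()
    have e2 := condEnt_chain μ Y X fun _ => ()
    have e3 : condEnt μ (joint X Y) (fun _ => ()) = condEnt μ (joint Y X) (fun _ => ()) :=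
      condEnt_congr (fun _ _ _ _ => Iff.rfl) fun _ _ _ _ => by
        simp only [Prod.mk.injEq]; tauto
    have e4 : condEnt μ Y (joint X fun _ => ()) = condEnt μ Y X :=
      condEnt_congr (fun _ _ _ _ => by simp) fun _ _ _ _ => by simp
    have e5 : condEnt μ X (joint Y fun _ => ()) = condEnt μ X Y :=
      condEnt_congr (fun _ _ _ _ => by simp) fun _ _ _ _ => by simp
    rw [← e4, ← e5, ← e1, ← e2, e3]
  have h2 := congrArg ENNReal.toReal h1
  rw [ENNReal.toReal_add (ent_ne_top _ _) (condEnt_ne_top _ _ _),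
    ENNReal.toReal_add (ent_ne_top _ _) (condEnt_ne_top _ _ _)] at h2
  rw [mutualInfo_eq_left]
  linarith

/-! ### Common information -/

theorem commonInfo_le_ent (μ : PMF Ω) (X : Ω → α) (Y : Ω → β) :
    commonInfo (μ.map (joint X Y)) ≤ ent μ X := by
  refine iSup_le fun f => iSup_le fun g => iSup_le fun _ => ?_
  rw [PMF.map_comp]
  refine (entropy_map μ fun ω => f (X ω)).trans_le ?_
  exact condEnt_mono_left fun ω ω' _ _ h _ => congrArg f h

/-- The hypothesis says that the conditional law of Q given X depends on X only through the label,
which makes X - L(X) - Q a Markov chain. -/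
theorem condEnt_label_eq {μ : PMF Ω} {X : Ω → α} {Q : Ω → κ} {L : α → δ}
    (hL : ∀ ω ω', μ ω ≠ 0 → μ ω' ≠ 0 → L (X ω) = L (X ω') → ∀ q,
      μ.map (joint X Q) (X ω, q) / μ.map X (X ω) =
        μ.map (joint X Q) (X ω', q) / μ.map X (X ω')) :
    condEnt μ X (joint (fun ω => L (X ω)) Q) = condEnt μ X fun ω => L (X ω) := by
  classical
  -- The chain in product form, p(l, q) p(x) = p(l) p(x, q), obtained by summing p(x', q) p(x) =
  -- p(x') p(x, q) over all x' with the label l of x.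
  have hL' : ∀ ω, μ ω ≠ 0 → ∀ q,
      μ.map (joint (fun ω => L (X ω)) Q) (L (X ω), q) * μ.map X (X ω) =
        μ.map (fun ω => L (X ω)) (L (X ω)) * μ.map (joint X Q) (X ω, q) := by
    intro ω hω q
    have e1 : μ.map (joint (fun ω => L (X ω)) Q) (L (X ω), q) =
        ∑' x, if L x = L (X ω) then μ.map (joint X Q) (x, q) else 0 := by
      simp only [map_apply_eq]
      rw [tsum_congr fun x => (by split_ifs <;> simp : (if L x = L (X ω) then
        ∑' ω, (if joint X Q ω = (x, q) then μ ω else 0) else 0) =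
          ∑' ω', if L x = L (X ω) then (if joint X Q ω' = (x, q) then μ ω' else 0) else 0),
        ENNReal.tsum_comm]
      refine tsum_congr fun ω' => ?_
      rw [tsum_eq_single (X ω')]
      · by_cases h1 : L (X ω') = L (X ω) <;> simp [h1]
      · intro x hx
        simp [Ne.symm hx]
    have e2 : μ.map (fun ω => L (X ω)) (L (X ω)) =
        ∑' x, if L x = L (X ω) then μ.map X x else 0 := by
      have := map_apply_eq (μ.map X) L (L (X ω))
      rwa [PMF.map_comp] at this
    rw [e1, e2, ← ENNReal.tsum_mul_right, ← ENNReal.tsum_mul_right]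
    refine tsum_congr fun x => ?_
    by_cases hx : L x = L (X ω)
    · rw [if_pos hx, if_pos hx]
      by_cases hx0 : μ.map X x = 0
      · have : μ.map (joint X Q) (x, q) = 0 := by
          rw [← tsum_map_pair_right μ X Q, ENNReal.tsum_eq_zero] at hx0
          exact hx0 q
        simp [hx0, this]
      · obtain ⟨ω', hω', rfl⟩ : ∃ ω', μ ω' ≠ 0 ∧ X ω' = x := by
          rw [← ne_eq, ← PMF.mem_support_iff, PMF.support_map] at hx0
          exact hx0
        have h := hL ω' ω hω' hω hx q
        have h1 := map_apply_ne_zero hω X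
        have h2 := map_apply_ne_top μ X (X ω)
        have h3 := map_apply_ne_zero hω' X
        have h4 := map_apply_ne_top μ X (X ω')
        calc _ = μ.map (joint X Q) (X ω', q) / μ.map X (X ω') * μ.map X (X ω') * μ.map X (X ω) := by
              rw [ENNReal.div_mul_cancel h3 h4]
          _ = μ.map X (X ω') * (μ.map (joint X Q) (X ω, q) / μ.map X (X ω) * μ.map X (X ω)) := by
              rw [h]; ring
          _ = _ := by rw [ENNReal.div_mul_cancel h1 h2]
    · rw [if_neg hx, if_neg hx, zero_mul, zero_mul]
  refine tsum_mul_congr fun ω hω => ?_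
  have h := congrArg ENNReal.toReal (hL' ω hω (Q ω))
  rw [ENNReal.toReal_mul, ENNReal.toReal_mul] at h
  change fiberProb μ (joint (fun ω => L (X ω)) Q) ω * fiberProb μ X ω =
    fiberProb μ (fun ω => L (X ω)) ω * fiberProb μ (joint X Q) ω at h
  have e1 : fiberProb μ (joint X (joint (fun ω => L (X ω)) Q)) ω = fiberProb μ (joint X Q) ω :=
    fiberProb_congr fun ω' _ => by
      simp only [Prod.mk.injEq]
      exact ⟨fun h => ⟨h.1, h.2.2⟩, fun h => ⟨h.1, congrArg L h.1, h.2⟩⟩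
  have e2 : fiberProb μ (joint X fun ω => L (X ω)) ω = fiberProb μ X ω :=
    fiberProb_congr fun ω' _ => by
      simp only [Prod.mk.injEq]
      exact ⟨fun h => h.1, fun h => ⟨h, congrArg L h⟩⟩
  rw [e1, e2, (div_eq_div_iff (fiberProb_pos hω _).ne' (fiberProb_pos hω _).ne').2 h]

/-- H(X) = H(L) + H(X | L) = H(L) + H(X | L, Q) ≤ H(L) + H(X | Q): everything that X and Q share
passes through the label. -/
theorem ent_le_of_label {μ : PMF Ω} {X : Ω → α} {Q : Ω → κ} {L : α → δ}
    (hL : ∀ ω ω', μ ω ≠ 0 → μ ω' ≠ 0 → L (X ω) = L (X ω') → ∀ q,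
      μ.map (joint X Q) (X ω, q) / μ.map X (X ω) =
        μ.map (joint X Q) (X ω', q) / μ.map X (X ω')) :
    ent μ X ≤ condEnt μ X Q + ent μ fun ω => L (X ω) := by
  have e : ent μ X = ent μ (fun ω => L (X ω)) + condEnt μ X (joint (fun ω => L (X ω)) fun _ => ()) :=
    condEnt_pair_of_det fun ω ω' _ _ h _ => congrArg L h
  have e' : condEnt μ X (joint (fun ω => L (X ω)) fun _ => ()) = condEnt μ X fun ω => L (X ω) :=
    condEnt_congr (fun _ _ _ _ => by simp) fun _ _ _ _ => by simp
  rw [e, e', ← condEnt_label_eq hL, add_comm]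
  gcongr
  exact condEnt_le_of_det X fun _ _ _ _ h => (Prod.ext_iff.1 h).2

/-- If `Q - X - Z` and `Q - Z - X` are Markov chains, then `I(X ; Q)` and `I(Z ; Q)` are at most the
common information of `X` and `Z`. -/
theorem ent_le_condEnt_add_commonInfo [Finite α] [Finite γ] {μ : PMF Ω} {X : Ω → α} {Z : Ω → γ}
    {Q : Ω → κ} (h1 : IsMarkovChain μ Q X Z) (h2 : IsMarkovChain μ Q Z X) :
    ent μ X ≤ condEnt μ X Q + commonInfo (μ.map (joint X Z)) ∧
      ent μ Z ≤ condEnt μ Z Q + commonInfo (μ.map (joint X Z)) := by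
  classical
  have hXZ : ∀ ω, μ ω ≠ 0 → ∀ q, μ.map (joint X Q) (X ω, q) / μ.map X (X ω) =
      μ.map (joint Z Q) (Z ω, q) / μ.map Z (Z ω) := by
    intro ω hω q
    have h := double_markov h2.symm h1.symm hω q
    rw [ENNReal.div_eq_div_iff (map_apply_ne_zero hω Z) (map_apply_ne_top _ _ _)
      (map_apply_ne_zero hω X) (map_apply_ne_top _ _ _)]
    rw [mul_comm, ← h, mul_comm]
  -- The label is the conditional law of Q. Values of X and of Z are placed in one sum type so that
  -- a single injection into ℕ encodes both kinds of label and equal laws receive equal numbers.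
  let F : α ⊕ γ → κ → ℝ≥0∞ := Sum.elim (fun x q => μ.map (joint X Q) (x, q) / μ.map X x)
    fun z q => μ.map (joint Z Q) (z, q) / μ.map Z z
  have : Countable (Set.range F) := (Set.finite_range F).countable.to_subtype
  obtain ⟨c, hc⟩ := exists_injective_nat (Set.range F)
  let L : α ⊕ γ → ℕ := fun s => c ⟨F s, Set.mem_range_self s⟩
  have hL : ∀ s s', L s = L s' ↔ F s = F s' := fun s s' =>
    hc.eq_iff.trans Subtype.ext_iff
  have hcommon : ∀ ω, μ ω ≠ 0 → L (.inl (X ω)) = L (.inr (Z ω)) := fun ω hω =>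
    (hL _ _).2 (funext fun q => hXZ ω hω q)
  have hle : ent μ (fun ω => L (.inl (X ω))) ≤ commonInfo (μ.map (joint X Z)) := by
    rw [← entropy_map]
    refine le_of_eq_of_le ?_ (le_iSup_of_le (fun x => L (.inl x))
      (le_iSup_of_le (fun z => L (.inr z)) (le_iSup_of_le ?_ le_rfl)))
    · rw [PMF.map_comp]; rfl
    · intro a b hab
      rw [← PMF.mem_support_iff, PMF.support_map] at hab
      obtain ⟨ω, hω, h⟩ := hab
      obtain ⟨rfl, rfl⟩ := Prod.mk.inj h
      exact hcommon ω hω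
  refine ⟨(ent_le_of_label (L := fun x => L (.inl x)) (Q := Q) ?_).trans (by gcongr),
    (ent_le_of_label (L := fun z => L (.inr z)) (Q := Q) ?_).trans ?_⟩
  · intro ω ω' _ _ h q
    exact congrFun ((hL _ _).1 h) q
  · intro ω ω' _ _ h q
    exact congrFun ((hL _ _).1 h) q
  · gcongr
    refine le_of_eq_of_le ?_ hle
    refine condEnt_congr (fun _ _ _ _ => Iff.rfl) fun ω ω' hω hω' => ?_
    rw [hcommon ω hω, hcommon ω' hω']

/-! ### Nonnegative interaction information -/

/-- `I(A ; B) ≥ I(A ; B | C)`, in terms of entropies that are conditional on `B` and `C`. -/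
def NonnegInteraction (μ : PMF Ω) (A : Ω → α) (B : Ω → β) (C : Ω → γ) : Prop :=
  condEnt μ A B + condEnt μ A C ≤ ent μ A + condEnt μ A (joint B C)

theorem NonnegInteraction.swap {μ : PMF Ω} {A : Ω → α} {B : Ω → β} {C : Ω → γ}
    (h : NonnegInteraction μ A B C) : NonnegInteraction μ A C B := by
  rw [NonnegInteraction, add_comm]
  refine h.trans_eq ?_
  rw [condEnt_congr (X := A) (Y := joint B C) (X' := A) (Y' := joint C B)
    (fun _ _ _ _ => by simp only [Prod.mk.injEq]; tauto)
    fun _ _ _ _ => by simp only [Prod.mk.injEq]; tauto]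

theorem NonnegInteraction.congr {μ : PMF Ω} {A : Ω → α} {B : Ω → β} {C : Ω → γ}
    {A' : Ω → α'} {B' : Ω → β'} {C' : Ω → γ'} (h : NonnegInteraction μ A B C)
    (hA : ∀ ω ω', μ ω ≠ 0 → μ ω' ≠ 0 → (A ω' = A ω ↔ A' ω' = A' ω))
    (hB : ∀ ω ω', μ ω ≠ 0 → μ ω' ≠ 0 → (B ω' = B ω ↔ B' ω' = B' ω))
    (hC : ∀ ω ω', μ ω ≠ 0 → μ ω' ≠ 0 → (C ω' = C ω ↔ C' ω' = C' ω)) :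
    NonnegInteraction μ A' B' C' := by
  have e1 : condEnt μ A B = condEnt μ A' B' := condEnt_congr hB fun ω ω' h1 h2 => by
    rw [hA ω ω' h1 h2, hB ω ω' h1 h2]
  have e2 : condEnt μ A C = condEnt μ A' C' := condEnt_congr hC fun ω ω' h1 h2 => by
    rw [hA ω ω' h1 h2, hC ω ω' h1 h2]
  have e3 : condEnt μ A (joint B C) = condEnt μ A' (joint B' C') :=
    condEnt_congr (fun ω ω' h1 h2 => by
      simp only [Prod.mk.injEq]; rw [hB ω ω' h1 h2, hC ω ω' h1 h2]) fun ω ω' h1 h2 => by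
      simp only [Prod.mk.injEq]; rw [hA ω ω' h1 h2, hB ω ω' h1 h2, hC ω ω' h1 h2]
  have e4 : ent μ A = ent μ A' := condEnt_congr (fun _ _ _ _ => Iff.rfl) fun ω ω' h1 h2 => by
    rw [hA ω ω' h1 h2]
  rw [NonnegInteraction, e1, e2, e3, e4] at h
  exact h

/-- Messages on the links `B` and `C` that depend on `(B, C)` only. -/
theorem NonnegInteraction.extend_right {μ : PMF Ω} {A : Ω → α} {B : Ω → β} {C : Ω → γ}
    {u : Ω → δ} {v : Ω → κ} (h : NonnegInteraction μ A B C)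
    (hM : IsMarkovChain μ (joint u v) (joint B C) A) :
    NonnegInteraction μ A (joint B u) (joint C v) := by
  have e : condEnt μ A (joint (joint B u) (joint C v)) = condEnt μ A (joint B C) := by
    rw [← hM.condEnt_eq]
    exact condEnt_congr (fun _ _ _ _ => by simp only [Prod.mk.injEq]; tauto)
      fun _ _ _ _ => by simp only [Prod.mk.injEq]; tauto
  rw [NonnegInteraction, e]
  refine le_trans (add_le_add ?_ ?_) h <;>
  exact condEnt_le_of_det A fun _ _ _ _ h => (Prod.ext_iff.1 h).1

/-- Messages on the links `A` and `C` that depend on `(A, C)` only. -/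
theorem NonnegInteraction.extend_left {μ : PMF Ω} {A : Ω → α} {B : Ω → β} {C : Ω → γ}
    {u : Ω → δ} {v : Ω → κ} (h : NonnegInteraction μ A B C)
    (hM : IsMarkovChain μ (joint u v) (joint A C) B) (hA : ent μ A ≠ ∞) :
    NonnegInteraction μ (joint A u) B (joint C v) := by
  -- The chain (u, v) - (A, C) - B in product form; `m2` is its marginal for v alone.
  have m1 : ∀ ω, fiberProb μ (joint u (joint A (joint B (joint C v)))) ω *
      fiberProb μ (joint A C) ω = fiberProb μ (joint u (joint A (joint C v))) ω *
        fiberProb μ (joint A (joint B C)) ω := by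
    intro ω
    have := hM.fiberProb_mul ω
    rw [fiberProb_congr (X := joint u (joint A (joint B (joint C v))))
        (Y := fun ω => (joint u v ω, joint A C ω, B ω)) fun ω' _ => by
          simp only [Prod.mk.injEq]; tauto,
      fiberProb_congr (X := joint u (joint A (joint C v)))
        (Y := joint (joint u v) (joint A C)) fun ω' _ => by simp only [Prod.mk.injEq]; tauto,
      fiberProb_congr (X := joint A (joint B C)) (Y := joint (joint A C) B) fun ω' _ => by
        simp only [Prod.mk.injEq]; tauto, this]
  have m2 : ∀ ω, fiberProb μ (joint A (joint B (joint C v))) ω *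
      fiberProb μ (joint A C) ω = fiberProb μ (joint A (joint C v)) ω *
        fiberProb μ (joint A (joint B C)) ω := by
    intro ω
    have := (hM.map_left Prod.snd).fiberProb_mul ω
    rw [fiberProb_congr (X := joint A (joint B (joint C v)))
        (Y := fun ω => ((joint u v ω).2, joint A C ω, B ω)) fun ω' _ => by
          simp only [Prod.mk.injEq]; tauto,
      fiberProb_congr (X := joint A (joint C v))
        (Y := joint (fun ω => (joint u v ω).2) (joint A C)) fun ω' _ => by
          simp only [Prod.mk.injEq]; tauto,
      fiberProb_congr (X := joint A (joint B C)) (Y := joint (joint A C) B) fun ω' _ => by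
        simp only [Prod.mk.injEq]; tauto, this]
  -- This is I(A; B | C, v) ≤ I(A; B | C). By `m2` the two sides differ by I(v; B | C), which is
  -- nonnegative.
  have key : condEnt μ A (joint C v) + condEnt μ A (joint B C) ≤
      condEnt μ A C + condEnt μ A (joint B (joint C v)) := by
    simp only [condEnt]
    rw [← ENNReal.tsum_add, ← ENNReal.tsum_add]
    simp only [← mul_add]
    rw [tsum_mul_congr fun ω hω => (ENNReal.ofReal_add (logb_joint_nonneg hω A (joint C v))
      (logb_joint_nonneg hω A (joint B C))).symm,
      tsum_mul_congr fun ω hω => (ENNReal.ofReal_add (logb_joint_nonneg hω A C)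
      (logb_joint_nonneg hω A (joint B (joint C v)))).symm]
    refine tsum_logb_le_of_ratio μ v B C _ _
      (fun ω hω => add_nonneg (logb_joint_nonneg hω _ _) (logb_joint_nonneg hω _ _))
      (fun ω hω => add_nonneg (logb_joint_nonneg hω _ _) (logb_joint_nonneg hω _ _))
      fun ω hω => ?_
    have e1 : fiberProb μ (joint v C) ω = fiberProb μ (joint C v) ω :=
      fiberProb_congr fun ω' _ => by simp only [Prod.mk.injEq]; tauto
    have e2 : fiberProb μ (joint v (joint B C)) ω = fiberProb μ (joint B (joint C v)) ω :=
      fiberProb_congr fun ω' _ => by simp only [Prod.mk.injEq]; tauto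
    have h1 := fiberProb_pos hω (joint C v)
    have h2 := fiberProb_pos hω (joint A (joint C v))
    have h3 := fiberProb_pos hω (joint B C)
    have h4 := fiberProb_pos hω (joint A (joint B C))
    have h5 := fiberProb_pos hω C
    have h6 := fiberProb_pos hω (joint A C)
    have h7 := fiberProb_pos hω (joint B (joint C v))
    have h8 := fiberProb_pos hω (joint A (joint B (joint C v)))
    have hm := m2 ω
    rw [e1, e2, ← Real.logb_mul (by positivity) (by positivity),
      ← Real.logb_mul (by positivity) (by positivity),
      ← Real.logb_mul (by positivity) (by positivity)]
    congr 1
    field_simp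
    linarith
  -- Given (A, C, v), the message u carries no information on B. Adding u to A thus leaves the
  -- conditional mutual information unchanged, while I(A; B) can only grow.
  have hu : condEnt μ u (joint A (joint B (joint C v))) = condEnt μ u (joint A (joint C v)) := by
    refine tsum_mul_congr fun ω hω => ?_
    have h1 := fiberProb_pos hω (joint u (joint A (joint B (joint C v))))
    have h2 := fiberProb_pos hω (joint u (joint A (joint C v)))
    have h3 := fiberProb_pos hω (joint A C)
    have h4 := fiberProb_pos hω (joint A (joint B C))
    rw [(div_eq_div_iff h1.ne' h2.ne').2]
    refine mul_right_cancel₀ (mul_pos h3 h4).ne' ?_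
    linear_combination (fiberProb μ (joint u (joint A (joint C v))) ω *
      fiberProb μ (joint A (joint B C)) ω) * m2 ω -
      (fiberProb μ (joint A (joint C v)) ω * fiberProb μ (joint A (joint B C)) ω) * m1 ω
  have hAC : condEnt μ A C ≠ ∞ := ne_top_of_le_ne_top hA (condEnt_le_ent _ _ _)
  have hABC : condEnt μ A (joint B C) ≠ ∞ := ne_top_of_le_ne_top hA (condEnt_le_ent _ _ _)
  have main : condEnt μ A B + condEnt μ A (joint C v) ≤
      ent μ A + condEnt μ A (joint B (joint C v)) := by
    refine (ENNReal.add_le_add_iff_right (ENNReal.add_ne_top.2 ⟨hAC, hABC⟩)).1 ?_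
    calc _ = (condEnt μ A B + condEnt μ A C) +
          (condEnt μ A (joint C v) + condEnt μ A (joint B C)) := by ring
      _ ≤ (ent μ A + condEnt μ A (joint B C)) +
          (condEnt μ A C + condEnt μ A (joint B (joint C v))) := add_le_add h key
      _ = _ := by ring
  rw [NonnegInteraction, ent, condEnt_chain, condEnt_chain, condEnt_chain, condEnt_chain, hu]
  calc _ = (condEnt μ A B + condEnt μ A (joint C v)) + condEnt μ u (joint A B) +
        condEnt μ u (joint A (joint C v)) := by ring
    _ ≤ (ent μ A + condEnt μ A (joint B (joint C v))) + condEnt μ u (joint A fun _ => ()) +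
        condEnt μ u (joint A (joint C v)) := by
        gcongr
        exact condEnt_le_of_det u fun _ _ _ _ h => by simpa using (Prod.ext_iff.1 h).1
    _ = _ := by ring

/-- `I(X ; B | C) ≤ I(A ; B | C) + H(X | A, C)`. -/
theorem condEnt_add_le_of_processing (μ : PMF Ω) (A : Ω → α) (B : Ω → β) (C : Ω → γ)
    (X : Ω → δ) :
    condEnt μ X C + condEnt μ A (joint B C) ≤
      condEnt μ X (joint B C) + condEnt μ A C + condEnt μ X (joint A C) := by
  have h1 : condEnt μ A (joint B C) ≤ condEnt μ X (joint B C) + condEnt μ A (joint X C) := by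
    calc _ ≤ condEnt μ (joint X A) (joint B C) :=
          condEnt_mono_left fun _ _ _ _ h _ => (Prod.ext_iff.1 h).2
      _ = _ := condEnt_chain _ _ _ _
      _ ≤ _ := by
        gcongr
        exact condEnt_le_of_det A fun _ _ _ _ h => by simp only [Prod.mk.injEq] at h ⊢; tauto
  have h2 : condEnt μ X C + condEnt μ A (joint X C) = condEnt μ A C + condEnt μ X (joint A C) := by
    rw [← condEnt_chain, ← condEnt_chain]
    exact condEnt_congr (fun _ _ _ _ => Iff.rfl) fun _ _ _ _ => by
      simp only [Prod.mk.injEq]; tauto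
  calc _ ≤ condEnt μ X C + (condEnt μ X (joint B C) + condEnt μ A (joint X C)) := by gcongr
    _ = condEnt μ X (joint B C) + (condEnt μ X C + condEnt μ A (joint X C)) := by ring
    _ = _ := by rw [h2]; ring

/-- Nonnegative interaction gives H(A) ≥ I(A; B | C) + I(A; C | B) + H(A | B, C). Data processing
bounds the three terms below by I(X; B | C), I(Y; C | B) and H(X, Y | B, C), up to H(X | A, C) and
H(Y | A, B). Each of these errors enters twice. They are kept because truncated transcripts need not
determine the inputs; they vanish only in the limit. -/
theorem NonnegInteraction.le_ent {μ : PMF Ω} {A : Ω → α} {B : Ω → β} {C : Ω → γ}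
    (h : NonnegInteraction μ A B C) (hA : ent μ A ≠ ∞) (X : Ω → δ) (Y : Ω → κ) :
    condEnt μ X C + condEnt μ Y B + condEnt μ (joint X Y) (joint B C) ≤
      ent μ A + (condEnt μ X (joint B C) + condEnt μ Y (joint B C) +
        2 * condEnt μ X (joint A C) + 2 * condEnt μ Y (joint A B)) := by
  have h1 := condEnt_add_le_of_processing μ A B C X
  have h2 : condEnt μ Y B + condEnt μ A (joint B C) ≤
      condEnt μ Y (joint B C) + condEnt μ A B + condEnt μ Y (joint A B) := by
    have h := condEnt_add_le_of_processing μ A C B Y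
    rwa [condEnt_congr (X := A) (Y := joint C B) (X' := A) (Y' := joint B C)
      (fun _ _ _ _ => by simp only [Prod.mk.injEq]; tauto)
      fun _ _ _ _ => by simp only [Prod.mk.injEq]; tauto,
      condEnt_congr (X := Y) (Y := joint C B) (X' := Y) (Y' := joint B C)
      (fun _ _ _ _ => by simp only [Prod.mk.injEq]; tauto)
      fun _ _ _ _ => by simp only [Prod.mk.injEq]; tauto] at h
  have h3 : condEnt μ (joint X Y) (joint B C) ≤
      condEnt μ A (joint B C) + condEnt μ X (joint A C) + condEnt μ Y (joint A B) := by
    calc _ ≤ condEnt μ (joint A (joint X Y)) (joint B C) :=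
          condEnt_mono_left fun _ _ _ _ h _ => (Prod.ext_iff.1 h).2
      _ = condEnt μ A (joint B C) + (condEnt μ X (joint A (joint B C)) +
          condEnt μ Y (joint X (joint A (joint B C)))) := by
          rw [condEnt_chain, condEnt_chain]
      _ ≤ condEnt μ A (joint B C) + (condEnt μ X (joint A C) + condEnt μ Y (joint A B)) := by
          gcongr
          · exact condEnt_le_of_det _ fun _ _ _ _ h => by simp only [Prod.mk.injEq] at h ⊢; tauto
          · exact condEnt_le_of_det _ fun _ _ _ _ h => by simp only [Prod.mk.injEq] at h ⊢; tauto
      _ = _ := by ring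
  have f1 : condEnt μ A C ≠ ∞ := ne_top_of_le_ne_top hA (condEnt_le_ent _ _ _)
  have f2 : condEnt μ A B ≠ ∞ := ne_top_of_le_ne_top hA (condEnt_le_ent _ _ _)
  have f3 : condEnt μ A (joint B C) ≠ ∞ := ne_top_of_le_ne_top hA (condEnt_le_ent _ _ _)
  -- The terms H(A | C), H(A | B) and twice H(A | B, C) are added to both sides in place of
  -- subtracting them; this is where finiteness of H(A) is used.
  refine (ENNReal.add_le_add_iff_right (ENNReal.add_ne_top.2 ⟨ENNReal.add_ne_top.2 ⟨f1, f2⟩,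
    ENNReal.add_ne_top.2 ⟨f3, f3⟩⟩)).1 ?_
  calc _ = (condEnt μ X C + condEnt μ A (joint B C)) + (condEnt μ Y B + condEnt μ A (joint B C)) +
        condEnt μ (joint X Y) (joint B C) + (condEnt μ A B + condEnt μ A C) := by ring
    _ ≤ (condEnt μ X (joint B C) + condEnt μ A C + condEnt μ X (joint A C)) +
        (condEnt μ Y (joint B C) + condEnt μ A B + condEnt μ Y (joint A B)) +
        (condEnt μ A (joint B C) + condEnt μ X (joint A C) + condEnt μ Y (joint A B)) +
        (ent μ A + condEnt μ A (joint B C)) :=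
      add_le_add (add_le_add (add_le_add h1 h2) h3) h
    _ = _ := by ring

/-! ### Limits -/

/-- Averaging over X inside each fiber of D turns the integrand into the entropy of the conditional
law of X. It is then bounded in terms of the size of the alphabet, unlike the logarithm in the
definition, and suits dominated convergence. -/
theorem condEnt_eq_tsum_sum [Fintype α] (μ : PMF Ω) (X : Ω → α) (D : Ω → β) :
    condEnt μ X D = ∑' ω, μ ω * ∑ x, ENNReal.ofReal (Real.negMulLog
      ((μ.map (joint X D) (x, D ω)).toReal / (μ.map D (D ω)).toReal) / Real.log 2) := by
  rw [← tsum_map_mul μ D fun d => ∑ x, ENNReal.ofReal (Real.negMulLog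
    ((μ.map (joint X D) (x, d)).toReal / (μ.map D d).toReal) / Real.log 2)]
  have e : condEnt μ X D = ∑' w, μ.map (joint X D) w * ENNReal.ofReal (Real.logb 2
      ((μ.map D w.2).toReal / (μ.map (joint X D) w).toReal)) :=
    (tsum_map_mul μ (joint X D) fun w => ENNReal.ofReal (Real.logb 2
      ((μ.map D w.2).toReal / (μ.map (joint X D) w).toReal))).symm
  rw [e, ENNReal.tsum_prod', ENNReal.tsum_comm]
  refine tsum_congr fun d => ?_
  rw [tsum_fintype, Finset.mul_sum]
  refine Finset.sum_congr rfl fun x _ => ?_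
  by_cases h0 : μ.map (joint X D) (x, d) = 0
  · simp [h0]
  have hd : μ.map D d ≠ 0 := by
    rw [← tsum_map_pair_left μ X D]
    exact fun h => h0 (ENNReal.tsum_eq_zero.1 h x)
  have h1 : 0 < (μ.map (joint X D) (x, d)).toReal := ENNReal.toReal_pos h0 (PMF.apply_ne_top _ _)
  have h2 : 0 < (μ.map D d).toReal := ENNReal.toReal_pos hd (PMF.apply_ne_top _ _)
  rw [← ENNReal.ofReal_toReal (PMF.apply_ne_top (μ.map (joint X D)) (x, d)),
    ← ENNReal.ofReal_toReal (PMF.apply_ne_top (μ.map D) d),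
    ← ENNReal.ofReal_mul h1.le, ← ENNReal.ofReal_mul h2.le, ENNReal.toReal_ofReal h1.le,
    ENNReal.toReal_ofReal h2.le, Real.negMulLog, Real.logb,
    ← inv_div (μ.map D d).toReal, Real.log_inv]
  congr 1
  field_simp

theorem tendsto_tsum_mul {μ : PMF Ω} {f : ℕ → Ω → ℝ≥0∞} {g : Ω → ℝ≥0∞} {K : ℝ≥0∞} (hK : K ≠ ∞)
    (hf : ∀ n ω, f n ω ≤ K)
    (h : ∀ ω, μ ω ≠ 0 → Filter.Tendsto (fun n => f n ω) Filter.atTop (nhds (g ω))) :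
    Filter.Tendsto (fun n => ∑' ω, μ ω * f n ω) Filter.atTop (nhds (∑' ω, μ ω * g ω)) := by
  let _ : MeasurableSpace Ω := ⊤
  simp only [← MeasureTheory.lintegral_count]
  refine MeasureTheory.tendsto_lintegral_of_dominated_convergence (fun ω => μ ω * K)
    (fun n => measurable_from_top) (fun n => Filter.Eventually.of_forall fun ω =>
      mul_le_mul' le_rfl (hf n ω)) ?_ (Filter.Eventually.of_forall fun ω => ?_)
  · rw [MeasureTheory.lintegral_count, ENNReal.tsum_mul_right, PMF.tsum_coe, one_mul]
    exact hK
  · by_cases hω : μ ω = 0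
    · simp [hω]
    · exact ENNReal.Tendsto.const_mul (h ω hω) (Or.inr (PMF.apply_ne_top μ ω))

theorem tendsto_map_apply {μ : PMF Ω} {D : ℕ → Ω → β} {D' : Ω → β}
    (h : ∀ ω, μ ω ≠ 0 → ∀ᶠ n in Filter.atTop, D n ω = D' ω) (d : β) :
    Filter.Tendsto (fun n => μ.map (D n) d) Filter.atTop (nhds (μ.map D' d)) := by
  classical
  have e : ∀ X : Ω → β, μ.map X d = ∑' ω, μ ω * if X ω = d then 1 else 0 := fun X => by
    rw [map_apply_eq]
    exact tsum_congr fun ω => by split_ifs <;> simp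
  simp only [e]
  refine tendsto_tsum_mul ENNReal.one_ne_top (fun n ω => by split_ifs <;> simp) fun ω hω => ?_
  refine tendsto_const_nhds.congr' ?_
  filter_upwards [h ω hω] with n hn
  rw [hn]

/-- Since D n is eventually constant at each point of the support, the conditional probabilities of
X converge pointwise. Finiteness of the alphabet of X supplies the dominating constant, so D may
have infinite entropy. -/
theorem tendsto_condEnt [Fintype α] {μ : PMF Ω} (X : Ω → α) {D : ℕ → Ω → β} {D' : Ω → β}
    (h : ∀ ω, μ ω ≠ 0 → ∀ᶠ n in Filter.atTop, D n ω = D' ω) :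
    Filter.Tendsto (fun n => condEnt μ X (D n)) Filter.atTop (nhds (condEnt μ X D')) := by
  simp only [condEnt_eq_tsum_sum]
  have hlog : 0 < Real.log 2 := Real.log_pos one_lt_two
  refine tendsto_tsum_mul (K := ∑ _x : α, ENNReal.ofReal (1 / Real.log 2))
    (ENNReal.sum_ne_top.2 fun _ _ => ENNReal.ofReal_ne_top) (fun n ω => ?_) fun ω hω => ?_
  · refine Finset.sum_le_sum fun x _ => ENNReal.ofReal_le_ofReal ?_
    gcongr
    have h0 : 0 ≤ (μ.map (joint X (D n)) (x, D n ω)).toReal / (μ.map (D n) (D n ω)).toReal := by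
      positivity
    -- The constant in `K` comes from -t log t ≤ 1 - t ≤ 1 for t ≥ 0.
    refine (Real.negMulLog_le_one_sub_self h0).trans ?_
    linarith
  · refine tendsto_finsetSum _ fun x _ => ENNReal.tendsto_ofReal (Filter.Tendsto.div_const ?_ _)
    refine (Real.continuous_negMulLog.tendsto _).comp (Filter.Tendsto.div ?_ ?_ ?_)
    · refine (ENNReal.tendsto_toReal (PMF.apply_ne_top _ _)).comp
        (Filter.Tendsto.congr' (f₁ := fun n => μ.map (joint X (D n)) (x, D' ω)) ?_ ?_)
      · filter_upwards [h ω hω] with n hn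
        rw [hn]
      · refine tendsto_map_apply (fun ω' hω' => ?_) _
        filter_upwards [h ω' hω'] with n hn
        rw [joint, hn]
    · refine (ENNReal.tendsto_toReal (PMF.apply_ne_top _ _)).comp
        (Filter.Tendsto.congr' (f₁ := fun n => μ.map (D n) (D' ω)) ?_ ?_)
      · filter_upwards [h ω hω] with n hn
        rw [hn]
      · exact tendsto_map_apply h _
    · exact (fiberProb_pos hω D').ne'

/-- The passage to the limit in `NonnegInteraction.le_ent`, where `(A, C)` determines `X` and
`(A, B)` determines `Y`. -/
theorem le_ent_of_nonnegInteraction [Fintype δ] [Fintype κ] {μ : PMF Ω} {A : Ω → α} {B : Ω → β}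
    {C : Ω → γ} {A' : ℕ → Ω → α} {B' : ℕ → Ω → β} {C' : ℕ → Ω → γ} {X : Ω → δ} {Y : Ω → κ}
    (hA : ∀ n ω ω', μ ω ≠ 0 → μ ω' ≠ 0 → A ω' = A ω → A' n ω' = A' n ω)
    (hB : ∀ n ω ω', μ ω ≠ 0 → μ ω' ≠ 0 → B ω' = B ω → B' n ω' = B' n ω)
    (hC : ∀ n ω ω', μ ω ≠ 0 → μ ω' ≠ 0 → C ω' = C ω → C' n ω' = C' n ω)
    (lA : ∀ ω, μ ω ≠ 0 → ∀ᶠ n in Filter.atTop, A' n ω = A ω)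
    (lB : ∀ ω, μ ω ≠ 0 → ∀ᶠ n in Filter.atTop, B' n ω = B ω)
    (lC : ∀ ω, μ ω ≠ 0 → ∀ᶠ n in Filter.atTop, C' n ω = C ω)
    (hI : (∀ n, ent μ (A' n) ≠ ∞) → ∀ n, NonnegInteraction μ (A' n) (B' n) (C' n))
    (hX : condEnt μ X (joint A C) = 0) (hY : condEnt μ Y (joint A B) = 0) :
    condEnt μ X C + condEnt μ Y B + condEnt μ (joint X Y) (joint B C) ≤
      ent μ A + (condEnt μ X (joint B C) + condEnt μ Y (joint B C)) := by
  by_cases hAtop : ent μ A = ∞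
  · simp [hAtop]
  have hA' : ∀ n, ent μ (A' n) ≤ ent μ A := fun n =>
    condEnt_mono_left fun ω ω' h h' e _ => hA n ω ω' h h' e
  have hAn : ∀ n, ent μ (A' n) ≠ ∞ := fun n => ne_top_of_le_ne_top hAtop (hA' n)
  -- On the left and in H(A) the truncations can be replaced by the full variables at once, because
  -- a truncation is a function of the full variable. Only the remaining terms on the right need a
  -- limit.
  have hle : ∀ n, condEnt μ X C + condEnt μ Y B + condEnt μ (joint X Y) (joint B C) ≤
      ent μ A + (condEnt μ X (joint (B' n) (C' n)) + condEnt μ Y (joint (B' n) (C' n)) +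
        2 * condEnt μ X (joint (A' n) (C' n)) + 2 * condEnt μ Y (joint (A' n) (B' n))) := by
    intro n
    refine le_trans ?_ (((hI hAn n).le_ent (hAn n) X Y).trans (add_le_add (hA' n) le_rfl))
    refine add_le_add (add_le_add ?_ ?_) ?_
    · exact condEnt_le_of_det X (hC n)
    · exact condEnt_le_of_det Y (hB n)
    · refine condEnt_le_of_det _ fun ω ω' h h' e => ?_
      obtain ⟨e1, e2⟩ := Prod.mk.inj e
      exact Prod.ext (hB n ω ω' h h' e1) (hC n ω ω' h h' e2)
  have lBC : ∀ ω, μ ω ≠ 0 → ∀ᶠ n in Filter.atTop, joint (B' n) (C' n) ω = joint B C ω :=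
    fun ω hω => by
      filter_upwards [lB ω hω, lC ω hω] with n h1 h2
      exact Prod.ext h1 h2
  have lAC : ∀ ω, μ ω ≠ 0 → ∀ᶠ n in Filter.atTop, joint (A' n) (C' n) ω = joint A C ω :=
    fun ω hω => by
      filter_upwards [lA ω hω, lC ω hω] with n h1 h2
      exact Prod.ext h1 h2
  have lAB : ∀ ω, μ ω ≠ 0 → ∀ᶠ n in Filter.atTop, joint (A' n) (B' n) ω = joint A B ω :=
    fun ω hω => by
      filter_upwards [lA ω hω, lB ω hω] with n h1 h2
      exact Prod.ext h1 h2
  have hlim := tendsto_const_nhds (x := ent μ A) (f := Filter.atTop (α := ℕ)) |>.add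
    ((((tendsto_condEnt X lBC).add (tendsto_condEnt Y lBC)).add
      (ENNReal.Tendsto.const_mul (a := 2) (tendsto_condEnt X lAC) (Or.inr ENNReal.ofNat_ne_top))).add
      (ENNReal.Tendsto.const_mul (a := 2) (tendsto_condEnt Y lAB) (Or.inr ENNReal.ofNat_ne_top)))
  refine (ge_of_tendsto' hlim hle).trans_eq ?_
  rw [hX, hY, mul_zero, add_zero, add_zero]

end Inequalities
end ThreeParty

namespace ThreeParty

section Bounds

variable {Ω α β γ 𝒳 𝒴 𝒵 : Type*} [Fintype 𝒳] [Fintype 𝒴] [Fintype 𝒵]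

/-! ### Lower bounds on the entropies of three links -/

theorem commonInfo_ne_top (μ : PMF Ω) (X : Ω → 𝒳) (Y : Ω → β) :
    commonInfo (μ.map (joint X Y)) ≠ ∞ :=
  ne_top_of_le_ne_top (ent_ne_top μ X) (commonInfo_le_ent μ X Y)

/-- The bound on the entropy of a link `B` of the party with the output `Z`. -/
theorem residualInfo_add_condEntropy_le {μ : PMF Ω} {X : Ω → 𝒳} {Y : Ω → 𝒴} {Z : Ω → 𝒵}
    {A : Ω → α} {B : Ω → β} {C : Ω → γ} (hXZ : IsMarkovChain μ C X Z) (hZX : IsMarkovChain μ C Z X)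
    (hM : IsMarkovChain μ (joint A C) X (joint Y Z))
    (hY : ∀ ω ω', μ ω ≠ 0 → μ ω' ≠ 0 → A ω' = A ω → B ω' = B ω → Y ω' = Y ω)
    (hZ : ∀ ω ω', μ ω ≠ 0 → μ ω' ≠ 0 → B ω' = B ω → C ω' = C ω → Z ω' = Z ω) :
    ENNReal.ofReal (residualInfo (μ.map (joint X Z)) +
      condEntropy (μ.map (joint (joint Y Z) X))) ≤ entropy (μ.map B) := by
  rw [entropy_map]
  by_cases hB : ent μ B = ∞
  · simp [hB]
  -- H(Z) ≤ H(Z | C) + common information.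
  have h1 := (ent_le_condEnt_add_commonInfo hXZ hZX).2
  -- Privacy allows (A, C) to be added to the condition X. With A known, Y is a function of B, so
  -- its remaining uncertainty is at most that of B.
  have h2 : condEnt μ (joint Y Z) X ≤ condEnt μ Z X + condEnt μ B (joint Z C) := by
    rw [← hM.condEnt_eq]
    have e : condEnt μ (joint Y Z) (joint (joint A C) X) =
        condEnt μ (joint Z Y) (joint (joint A C) X) :=
      condEnt_congr (fun _ _ _ _ => Iff.rfl) fun _ _ _ _ => by
        simp only [Prod.mk.injEq]; tauto
    rw [e, condEnt_chain]
    refine add_le_add (condEnt_le_of_det Z fun _ _ _ _ h => (Prod.ext_iff.1 h).2) ?_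
    refine le_trans (condEnt_mono_left (X := B) fun ω ω' h h' e1 e2 => ?_)
      (condEnt_le_of_det B fun _ _ _ _ h => ?_)
    · simp only [Prod.mk.injEq] at e2
      exact hY ω ω' h h' e2.2.1.1 e1
    · simp only [Prod.mk.injEq] at h ⊢
      tauto
  -- The left side is H(B | C), because (B, C) determines Z.
  have h3 : condEnt μ Z C + condEnt μ B (joint Z C) ≤ ent μ B := by
    rw [← condEnt_pair_of_det fun ω ω' h h' e1 e2 => hZ ω ω' h h' e1 e2]
    exact condEnt_le_ent _ _ _
  have h4 : ent μ Z + condEnt μ (joint Y Z) X ≤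
      ent μ B + condEnt μ Z X + commonInfo (μ.map (joint X Z)) := by
    calc _ ≤ (condEnt μ Z C + commonInfo (μ.map (joint X Z))) +
          (condEnt μ Z X + condEnt μ B (joint Z C)) := add_le_add h1 h2
      _ = (condEnt μ Z C + condEnt μ B (joint Z C)) + condEnt μ Z X +
          commonInfo (μ.map (joint X Z)) := by ring
      _ ≤ _ := by gcongr
  have hc := commonInfo_ne_top μ X Z
  have h5 := ENNReal.toReal_mono (ENNReal.add_ne_top.2
    ⟨ENNReal.add_ne_top.2 ⟨hB, condEnt_ne_top μ Z X⟩, hc⟩) h4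
  rw [ENNReal.toReal_add (ent_ne_top _ _) (condEnt_ne_top _ _ _),
    ENNReal.toReal_add (ENNReal.add_ne_top.2 ⟨hB, condEnt_ne_top μ Z X⟩) hc,
    ENNReal.toReal_add hB (condEnt_ne_top _ _ _), toReal_condEnt μ (joint Y Z) X] at h5
  rw [ENNReal.ofReal_le_iff_le_toReal hB, residualInfo, mutualInfo_eq_right]
  linarith

/-- The bound on the entropy of the link `A` between the parties with the inputs `X` and `Y`. -/
theorem residualInfo_add_residualInfo_add_condEntropy_le {μ : PMF Ω} {X : Ω → 𝒳} {Y : Ω → 𝒴}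
    {Z : Ω → 𝒵} {A : Ω → α} {B : Ω → β} {C : Ω → γ}
    (hXZ : IsMarkovChain μ C X Z) (hYZ : IsMarkovChain μ B Y Z)
    (hM : IsMarkovChain μ (joint B C) Z (joint X Y))
    (hZ : ∀ ω ω', μ ω ≠ 0 → μ ω' ≠ 0 → B ω' = B ω → C ω' = C ω → Z ω' = Z ω)
    (h : condEnt μ X C + condEnt μ Y B + condEnt μ (joint X Y) (joint B C) ≤
      ent μ A + (condEnt μ X (joint B C) + condEnt μ Y (joint B C))) :
    ENNReal.ofReal (residualInfo (μ.map (joint X Z)) + residualInfo (μ.map (joint Y Z)) +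
      condEntropy (μ.map (joint (joint X Y) Z))) ≤ entropy (μ.map A) := by
  rw [entropy_map]
  by_cases hA : ent μ A = ∞
  · simp [hA]
  have hX := (hM.map_right Prod.fst).condEnt_eq
  have hY := (hM.map_right Prod.snd).condEnt_eq
  have hZX : IsMarkovChain μ C Z X := (hM.map_right Prod.fst).map_left Prod.snd
  have hZY : IsMarkovChain μ B Z Y := (hM.map_right Prod.snd).map_left Prod.fst
  have h1 := (ent_le_condEnt_add_commonInfo hXZ hZX).1
  have h2 := (ent_le_condEnt_add_commonInfo hYZ hZY).1
  -- Since (B, C) determines Z, Z may be added to the condition for free; privacy against Charlie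
  -- then removes (B, C).
  have e1 : condEnt μ (joint X Y) (joint B C) = condEnt μ (joint X Y) Z :=
    (condEnt_congr (fun ω ω' h1 h2 => by
      have := hZ ω ω' h1 h2
      simp only [Prod.mk.injEq]; tauto) fun ω ω' h1 h2 => by
      have := hZ ω ω' h1 h2
      simp only [Prod.mk.injEq]; tauto).trans hM.condEnt_eq
  have e2 : condEnt μ X (joint B C) = condEnt μ X Z :=
    (condEnt_congr (fun ω ω' h1 h2 => by
      have := hZ ω ω' h1 h2
      simp only [Prod.mk.injEq]; tauto) fun ω ω' h1 h2 => by
      have := hZ ω ω' h1 h2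
      simp only [Prod.mk.injEq]; tauto).trans hX
  have e3 : condEnt μ Y (joint B C) = condEnt μ Y Z :=
    (condEnt_congr (fun ω ω' h1 h2 => by
      have := hZ ω ω' h1 h2
      simp only [Prod.mk.injEq]; tauto) fun ω ω' h1 h2 => by
      have := hZ ω ω' h1 h2
      simp only [Prod.mk.injEq]; tauto).trans hY
  rw [e1, e2, e3] at h
  have hc1 := commonInfo_ne_top μ X Z
  have hc2 := commonInfo_ne_top μ Y Z
  have h5 := ENNReal.toReal_mono (ENNReal.add_ne_top.2
    ⟨hA, ENNReal.add_ne_top.2 ⟨condEnt_ne_top μ X Z, condEnt_ne_top μ Y Z⟩⟩) h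
  have h6 := ENNReal.toReal_mono (ENNReal.add_ne_top.2 ⟨condEnt_ne_top μ X C, hc1⟩) h1
  have h7 := ENNReal.toReal_mono (ENNReal.add_ne_top.2 ⟨condEnt_ne_top μ Y B, hc2⟩) h2
  rw [ENNReal.toReal_add (condEnt_ne_top _ _ _) hc1] at h6
  rw [ENNReal.toReal_add (condEnt_ne_top _ _ _) hc2] at h7
  rw [ENNReal.toReal_add (ENNReal.add_ne_top.2 ⟨condEnt_ne_top _ _ _, condEnt_ne_top _ _ _⟩)
      (condEnt_ne_top _ _ _), ENNReal.toReal_add (condEnt_ne_top _ _ _) (condEnt_ne_top _ _ _),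
    ENNReal.toReal_add hA (ENNReal.add_ne_top.2 ⟨condEnt_ne_top _ _ _, condEnt_ne_top _ _ _⟩),
    ENNReal.toReal_add (condEnt_ne_top _ _ _) (condEnt_ne_top _ _ _),
    toReal_condEnt μ (joint X Y) Z] at h5
  rw [ENNReal.ofReal_le_iff_le_toReal hA, residualInfo, residualInfo, mutualInfo_eq_left,
    mutualInfo_eq_left]
  linarith

end Bounds
end ThreeParty

namespace ThreeParty

/-! ### The joint law of the link histories -/

section Views

variable {𝒳 𝒴 𝒵 : Type*}

/-- The inputs and the histories of the links 12, 23 and 31. -/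
abbrev View (𝒳 𝒴 : Type*) := 𝒳 × 𝒴 × LinkHist × LinkHist × LinkHist

/-- The pairs of messages sent by the three parties in one round. -/
abbrev Messages := LinkMsg × LinkMsg × LinkMsg

def State.view (s : State 𝒳 𝒴) : View 𝒳 𝒴 := (s.x, s.y, s.link12, s.link23, s.link31)

/-- The round in which the parties send the given messages. -/
def Messages.toRound (m : Messages) : Round :=
  { m12 := m.1.1, m13 := m.1.2, m21 := m.2.1.1, m23 := m.2.1.2, m31 := m.2.2.1, m32 := m.2.2.2 }

/-- The view after one more round. -/
def View.extend (p : View 𝒳 𝒴 × Messages) : View 𝒳 𝒴 :=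
  (p.1.1, p.1.2.1, p.1.2.2.1 ++ [(p.2.1.1, p.2.2.1.1)],
    p.1.2.2.2.1 ++ [(p.2.2.1.2, p.2.2.2.2)], p.1.2.2.2.2 ++ [(p.2.2.2.1, p.2.1.2)])

theorem State.view_append (s : State 𝒳 𝒴) (m : Messages) :
    (s.append m.toRound).view = View.extend (s.view, m) := by
  simp [State.view, State.append, View.extend, Messages.toRound, State.link12, State.link23,
    State.link31]

theorem bind_map_pair_apply {α β : Type*} (p : PMF α) (q : α → PMF β) (a : α) (b : β) :
    (p.bind fun a => (q a).map fun b => (a, b)) (a, b) = p a * q a b := by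
  classical
  rw [PMF.bind_apply, tsum_eq_single a]
  · rw [map_apply_eq, tsum_eq_single b]
    · simp
    · intro b' hb
      simp [hb]
  · intro a' ha
    rw [map_apply_eq]
    simp [ha]

namespace Protocol

variable (P : Protocol 𝒳 𝒴 𝒵) (pXY : PMF (𝒳 × 𝒴))

/-- The law of the messages sent in the next round. -/
def messageLaw (w : View 𝒳 𝒴) : PMF Messages :=
  (P.alice w.1 w.2.2.1 w.2.2.2.2).bind fun a =>
    ((P.bob w.2.1 w.2.2.1 w.2.2.2.1).bind fun b =>
      (P.charlie w.2.2.2.1 w.2.2.2.2).map fun c => (b, c)).map fun bc => (a, bc)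

theorem messageLaw_apply (w : View 𝒳 𝒴) (a b c : LinkMsg) :
    P.messageLaw w (a, b, c) = P.alice w.1 w.2.2.1 w.2.2.2.2 a *
      (P.bob w.2.1 w.2.2.1 w.2.2.2.1 b * P.charlie w.2.2.2.1 w.2.2.2.2 c) := by
  rw [messageLaw, bind_map_pair_apply, bind_map_pair_apply]

theorem roundLaw_eq (s : State 𝒳 𝒴) : P.roundLaw s = (P.messageLaw s.view).map Messages.toRound := by
  simp only [roundLaw, messageLaw, State.view, PMF.map_bind, PMF.map_comp]
  rfl

/-- The joint law of the inputs and the link histories after `n` rounds. -/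
def viewLaw (n : ℕ) : PMF (View 𝒳 𝒴) := (P.stateLaw pXY n).map State.view

/-- The joint law of the view after `n` rounds and the messages of the next round. -/
def viewMessageLaw (n : ℕ) : PMF (View 𝒳 𝒴 × Messages) :=
  (P.viewLaw pXY n).bind fun w => (P.messageLaw w).map fun m => (w, m)

theorem viewLaw_succ (n : ℕ) :
    P.viewLaw pXY (n + 1) = (P.viewMessageLaw pXY n).map View.extend := by
  simp only [viewLaw, viewMessageLaw, stateLaw, PMF.map_bind, PMF.bind_map, PMF.map_comp,
    roundLaw_eq]
  congr 1
  funext s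
  simp only [Function.comp_apply, PMF.map_comp]
  congr 1
  funext m
  exact s.view_append m

theorem viewMessageLaw_map_fst (n : ℕ) :
    (P.viewMessageLaw pXY n).map Prod.fst = P.viewLaw pXY n := by
  simp only [viewMessageLaw, PMF.map_bind, PMF.map_comp]
  have : ∀ w : View 𝒳 𝒴, (P.messageLaw w).map (Prod.fst ∘ fun m => (w, m)) = PMF.pure w :=
    fun w => PMF.map_const _ w
  simp only [this, PMF.bind_pure]

theorem viewMessageLaw_apply (n : ℕ) (w : View 𝒳 𝒴) (m : Messages) :
    P.viewMessageLaw pXY n (w, m) = P.viewLaw pXY n w * P.messageLaw w m :=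
  bind_map_pair_apply _ _ _ _

/-- For independent inputs the law of the view is a product of three factors, each of which
depends on what one of the parties sees. -/
theorem exists_viewLaw_eq_mul (pX : PMF 𝒳) (pY : PMF 𝒴) (n : ℕ) :
    ∃ (a : 𝒳 → LinkHist → LinkHist → ℝ≥0∞) (b : 𝒴 → LinkHist → LinkHist → ℝ≥0∞)
      (c : LinkHist → LinkHist → ℝ≥0∞), ∀ x y A B C,
      P.viewLaw (prodLaw pX pY) n (x, y, A, B, C) = a x A C * b y A B * c B C := by
  classical
  induction n with
  | zero =>
    refine ⟨fun x A C => if A = [] ∧ C = [] then pX x else 0,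
      fun y A B => if A = [] ∧ B = [] then pY y else 0, fun _ _ => 1, fun x y A B C => ?_⟩
    have e : P.viewLaw (prodLaw pX pY) 0 =
        (prodLaw pX pY).map fun xy => (xy.1, xy.2, [], [], []) := by
      rw [viewLaw, stateLaw, PMF.map_comp]
      rfl
    rw [e, map_apply_eq, tsum_eq_single (x, y)]
    · rw [prodLaw, bind_map_pair_apply]
      by_cases hA : A = [] <;> by_cases hB : B = [] <;> by_cases hC : C = [] <;>
        simp [hA, hB, hC, eq_comm]
    · rintro ⟨x', y'⟩ h
      rw [if_neg]
      simp only [Prod.mk.injEq]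
      rintro ⟨rfl, rfl, -⟩
      exact h rfl
  | succ n ih =>
    obtain ⟨a, b, c, h⟩ := ih
    -- The factors of the next round read the new messages off the last entries of the histories.
    -- The default value is harmless: the guards in the first two factors make the product vanish
    -- when any of the three histories is empty, so the third needs no guard.
    let l : LinkHist → LinkMsg := fun h => h.getLast?.getD ([], [])
    refine ⟨fun x A C => if A ≠ [] ∧ C ≠ [] then a x A.dropLast C.dropLast *
        P.alice x A.dropLast C.dropLast ((l A).1, (l C).2) else 0,
      fun y A B => if A ≠ [] ∧ B ≠ [] then b y A.dropLast B.dropLast *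
        P.bob y A.dropLast B.dropLast ((l A).2, (l B).1) else 0,
      fun B C => c B.dropLast C.dropLast *
        P.charlie B.dropLast C.dropLast ((l C).1, (l B).2), fun x y A B C => ?_⟩
    rw [viewLaw_succ, map_apply_eq]
    rcases List.eq_nil_or_concat A with rfl | ⟨A, p, rfl⟩
    · simp [View.extend]
    rcases List.eq_nil_or_concat B with rfl | ⟨B, q, rfl⟩
    · simp [View.extend]
    rcases List.eq_nil_or_concat C with rfl | ⟨C, r, rfl⟩
    · simp [View.extend]
    -- Extension of a view is injective: the last entries p, q, r of links 12, 23, 31 are regrouped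
    -- by sender.
    rw [tsum_eq_single ((x, y, A, B, C), (p.1, r.2), (p.2, q.1), (r.1, q.2))]
    · rw [viewMessageLaw_apply, messageLaw_apply, h]
      simp [View.extend, l]
      ring
    · rintro ⟨⟨x', y', A', B', C'⟩, ⟨m12, m13⟩, ⟨m21, m23⟩, ⟨m31, m32⟩⟩ hne
      rw [if_neg]
      intro h'
      simp only [View.extend, Prod.mk.injEq, List.concat_eq_append] at h'
      refine hne ?_
      obtain ⟨h1, h2, h3, h4, h5⟩ := h'
      obtain ⟨h3, h3'⟩ := List.append_inj' h3 rfl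
      obtain ⟨h4, h4'⟩ := List.append_inj' h4 rfl
      obtain ⟨h5, h5'⟩ := List.append_inj' h5 rfl
      simp only [List.cons.injEq, and_true] at h3' h4' h5'
      simp [← h1, ← h2, ← h3, ← h4, ← h5, ← h3', ← h4', ← h5']

/-- Once the histories of links 12 and 31 are fixed, the three-factor form is a function of x times
a function of y and the history of link 23. -/
theorem isMarkovChain_alice (pX : PMF 𝒳) (pY : PMF 𝒴) (n : ℕ) :
    IsMarkovChain (P.viewLaw (prodLaw pX pY) n) (fun w => w.1) (fun w => (w.2.2.1, w.2.2.2.2))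
      fun w => (w.2.1, w.2.2.2.1) := by
  obtain ⟨a, b, c, h⟩ := P.exists_viewLaw_eq_mul pX pY n
  exact isMarkovChain_of_factor (fun x u v => (x, v.1, u.1, v.2, u.2)) (fun _ => rfl)
    (fun _ _ _ => rfl) (fun _ _ _ => rfl) (fun _ _ _ => rfl) (fun x u => a x u.1 u.2)
    (fun u v => b v.1 u.1 v.2 * c v.2 u.2) fun x u v => by rw [h]; ring

theorem isMarkovChain_bob (pX : PMF 𝒳) (pY : PMF 𝒴) (n : ℕ) :
    IsMarkovChain (P.viewLaw (prodLaw pX pY) n) (fun w => w.2.1)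
      (fun w => (w.2.2.1, w.2.2.2.1)) fun w => (w.1, w.2.2.2.2) := by
  obtain ⟨a, b, c, h⟩ := P.exists_viewLaw_eq_mul pX pY n
  exact isMarkovChain_of_factor (fun y u v => (v.1, y, u.1, u.2, v.2)) (fun _ => rfl)
    (fun _ _ _ => rfl) (fun _ _ _ => rfl) (fun _ _ _ => rfl) (fun y u => b y u.1 u.2)
    (fun u v => a v.1 u.1 v.2 * c u.2 v.2) fun y u v => by rw [h]; ring

theorem nonnegInteraction_map {Ω Ω' α β γ : Type*} (μ : PMF Ω) (f : Ω → Ω') (A : Ω' → α)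
    (B : Ω' → β) (C : Ω' → γ) : NonnegInteraction (μ.map f) A B C ↔
      NonnegInteraction μ (fun ω => A (f ω)) (fun ω => B (f ω)) fun ω => C (f ω) := by
  simp only [NonnegInteraction, ent, condEnt_map]

/-- For independent inputs the interaction information of the three links is nonnegative. -/
theorem nonnegInteraction_viewLaw (pX : PMF 𝒳) (pY : PMF 𝒴)
    (hfin : ∀ n, ent (P.viewLaw (prodLaw pX pY) n) (fun w => w.2.2.1) ≠ ∞) (n : ℕ) :
    NonnegInteraction (P.viewLaw (prodLaw pX pY) n) (fun w => w.2.2.1) (fun w => w.2.2.2.1)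
      fun w => w.2.2.2.2 := by
  induction n with
  | zero =>
    have e : P.viewLaw (prodLaw pX pY) 0 =
        (prodLaw pX pY).map fun xy => (xy.1, xy.2, [], [], []) := by
      rw [viewLaw, stateLaw, PMF.map_comp]
      rfl
    rw [e, nonnegInteraction_map, NonnegInteraction, condEnt_eq_zero_of_det fun _ _ _ _ _ => rfl,
      condEnt_eq_zero_of_det fun _ _ _ _ _ => rfl, add_zero]
    exact zero_le
  | succ n ih =>
    obtain ⟨a, b, c, h⟩ := P.exists_viewLaw_eq_mul pX pY n
    have hfin' := hfin (n + 1)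
    have hfin0 := hfin n
    rw [viewLaw_succ, ent, condEnt_map] at hfin'
    rw [← viewMessageLaw_map_fst, ent, condEnt_map] at hfin0
    rw [viewLaw_succ, nonnegInteraction_map]
    rw [← viewMessageLaw_map_fst, nonnegInteraction_map] at ih
    have hμ : ∀ x y A B C a' b' c', P.viewMessageLaw (prodLaw pX pY) n
        ((x, y, A, B, C), a', b', c') = (a x A C * b y A B * c B C) *
          (P.alice x A C a' * (P.bob y A B b' * P.charlie B C c')) := by
      intro x y A B C a' b' c'
      rw [viewMessageLaw_apply, messageLaw_apply, h]
    set μ := P.viewMessageLaw (prodLaw pX pY) n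
    -- The simultaneous messages of a round are appended one party at a time: Charlie, Alice, Bob.
    -- The middle terms of `ha` and `hb` already contain the messages appended earlier on the links
    -- of that party. Inputs are absorbed into the outer terms through the factorization.
    have hc : IsMarkovChain μ (fun w => w.2.2.2) (fun w => (w.1.2.2.2.1, w.1.2.2.2.2))
        fun w => (w.1.1, w.1.2.1, w.1.2.2.1, w.2.1, w.2.2.1) :=
      isMarkovChain_of_factor
        (fun t u v => ((v.1, v.2.1, v.2.2.1, u.1, u.2), v.2.2.2.1, v.2.2.2.2, t)) (fun _ => rfl)
        (fun _ _ _ => rfl) (fun _ _ _ => rfl) (fun _ _ _ => rfl)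
        (fun t u => c u.1 u.2 * P.charlie u.1 u.2 t)
        (fun u v => a v.1 v.2.2.1 u.2 * b v.2.1 v.2.2.1 u.1 *
          (P.alice v.1 v.2.2.1 u.2 v.2.2.2.1 * P.bob v.2.1 v.2.2.1 u.1 v.2.2.2.2))
        fun t u v => by rw [hμ]; ring
    have ha : IsMarkovChain μ (fun w => (w.1.1, w.2.1))
        (fun w => (w.1.2.2.1, w.1.2.2.2.2, w.2.2.2.1))
        fun w => (w.1.2.1, w.1.2.2.2.1, w.2.2.1, w.2.2.2.2) :=
      isMarkovChain_of_factor
        (fun t u v => ((t.1, v.1, u.1, v.2.1, u.2.1), t.2, v.2.2.1, (u.2.2, v.2.2.2)))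
        (fun _ => rfl) (fun _ _ _ => rfl) (fun _ _ _ => rfl) (fun _ _ _ => rfl)
        (fun t u => a t.1 u.1 u.2.1 * P.alice t.1 u.1 u.2.1 t.2)
        (fun u v => b v.1 u.1 v.2.1 * c v.2.1 u.2.1 *
          (P.bob v.1 u.1 v.2.1 v.2.2.1 * P.charlie v.2.1 u.2.1 (u.2.2, v.2.2.2)))
        fun t u v => by rw [hμ]; ring
    have hb : IsMarkovChain μ (fun w => (w.1.2.1, w.2.2.1))
        (fun w => ((w.1.2.2.1, w.2.1.1), w.1.2.2.2.1, w.2.2.2.2))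
        fun w => (w.1.1, (w.1.2.2.2.2, w.2.2.2.1), w.2.1.2) :=
      isMarkovChain_of_factor
        (fun t u v => ((v.1, t.1, u.1.1, u.2.1, v.2.1.1), (u.1.2, v.2.2), t.2, (v.2.1.2, u.2.2)))
        (fun _ => rfl) (fun _ _ _ => rfl) (fun _ _ _ => rfl) (fun _ _ _ => rfl)
        (fun t u => b t.1 u.1.1 u.2.1 * P.bob t.1 u.1.1 u.2.1 t.2)
        (fun u v => a v.1 u.1.1 v.2.1.1 * c u.2.1 v.2.1.1 *
          (P.alice v.1 u.1.1 v.2.1.1 (u.1.2, v.2.2) * P.charlie u.2.1 v.2.1.1 (v.2.1.2, u.2.2)))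
        fun t u v => by rw [hμ]; ring
    -- When Bob's messages are appended, link 12 already carries Alice's new message; this
    -- intermediate history is a function of the history after the round.
    have hfin1 : ent μ (joint (fun w => w.1.2.2.1) fun w => w.2.1.1) ≠ ∞ := by
      refine ne_top_of_le_ne_top hfin' (condEnt_mono_left fun ω ω' _ _ h _ => ?_)
      obtain ⟨h1, h2⟩ := List.append_inj' h rfl
      simp only [List.cons.injEq, Prod.mk.injEq, and_true] at h2
      exact Prod.ext h1 h2.1
    -- Charlie writes on links 23 and 31 only. Alice writes on 12 and 31, and Bob on 12 and 23;
    -- Bob's case is Alice's with links 23 and 31 exchanged, hence the swaps.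
    have s1 := ih.extend_right (u := fun w => w.2.2.2.2) (v := fun w => w.2.2.2.1)
      ((hc.map_left Prod.swap).map_right fun v => v.2.2.1)
    have s2 := s1.extend_left (u := fun w => w.2.1.1) (v := fun w => w.2.1.2)
      ((ha.map_left Prod.snd).map_right fun v => (v.2.1, v.2.2.2)) hfin0
    have s3 := (s2.swap.extend_left (u := fun w => w.2.2.1.1) (v := fun w => w.2.2.1.2)
      ((hb.map_left Prod.snd).map_right Prod.snd) hfin1).swap
    refine s3.congr ?_ ?_ ?_ <;>
    · intro ω ω' _ _
      simp only [View.extend, joint, Prod.mk.injEq]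
      constructor
      · intro h
        simp [h.1.1, h.1.2, h.2]
      · intro h
        obtain ⟨h1, h2⟩ := List.append_inj' h rfl
        simp only [List.cons.injEq, Prod.mk.injEq, and_true] at h2
        simp [h1, h2]

end Protocol

end Views
end ThreeParty

namespace ThreeParty

section Coupling

variable {𝒳 𝒴 𝒵 : Type*}

/-! ### Transcripts determine link histories -/

/-- The messages of a history are code words of codes determined by the preceding messages. -/
def LinkHist.Coded (C D : LinkHist → Set (List Bool)) (h : LinkHist) : Prop :=
  ∀ (g : LinkHist) (m : LinkMsg) (r : LinkHist), h = g ++ m :: r → m.1 ∈ C g ∧ m.2 ∈ D g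

theorem LinkHist.coded_nil (C D : LinkHist → Set (List Bool)) : LinkHist.Coded C D [] := by
  intro g m r h
  simp at h

theorem LinkHist.Coded.concat {C D : LinkHist → Set (List Bool)} {h : LinkHist}
    (hh : h.Coded C D) {m : LinkMsg} (h1 : m.1 ∈ C h) (h2 : m.2 ∈ D h) :
    LinkHist.Coded C D (h ++ [m]) := by
  intro g m' r e
  rcases List.eq_nil_or_concat r with rfl | ⟨r, p, rfl⟩
  · obtain ⟨rfl, e2⟩ := List.append_inj' e rfl
    simp only [List.cons.injEq, and_true] at e2
    rw [← e2]
    exact ⟨h1, h2⟩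
  · rw [List.concat_eq_append, ← List.cons_append, ← List.append_assoc] at e
    exact hh g m' r (List.append_inj' e rfl).1

theorem PrefixFree.eq_of_append_eq {C : Set (List Bool)} (hC : PrefixFree C) {u v r r' : List Bool}
    (hu : u ∈ C) (hv : v ∈ C) (h : u ++ r = v ++ r') : u = v := by
  rcases List.prefix_or_prefix_of_prefix (List.prefix_append u r) (h ▸ List.prefix_append v r')
    with h | h
  · exact hC u hu v hv h
  · exact (hC v hv u hu h).symm

/-- Unique decoding round by round: equal pasts give the same pair of prefix-free codes, which
identify the next messages at the head of the remaining bits. Equal lengths are needed because the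
transcript does not show trailing empty rounds. -/
theorem LinkHist.Coded.eq_of_transcript_eq {C D : LinkHist → Set (List Bool)}
    (hC : ∀ h, PrefixFree (C h)) (hD : ∀ h, PrefixFree (D h)) {h h' : LinkHist}
    (hh : h.Coded C D) (hh' : h'.Coded C D) (hl : h.length = h'.length)
    (ht : h.transcript = h'.transcript) : h = h' := by
  -- Generalized over a common past `g`, since the codes of the next round depend on it.
  suffices key : ∀ (r r' g : LinkHist), LinkHist.Coded C D (g ++ r) →
      LinkHist.Coded C D (g ++ r') → r.length = r'.length →
      LinkHist.transcript r = LinkHist.transcript r' → r = r' from key h h' [] hh hh' hl ht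
  intro r
  induction r with
  | nil =>
    intro r' g _ _ hl _
    exact (List.length_eq_zero_iff.1 hl.symm).symm
  | cons m r ih =>
    intro r' g h1 h2 hl ht
    cases r' with
    | nil => simp at hl
    | cons m' r' =>
      obtain ⟨a1, a2⟩ := h1 g m r rfl
      obtain ⟨b1, b2⟩ := h2 g m' r' rfl
      simp only [LinkHist.transcript, List.map_cons, List.flatten_cons, Prod.mk.injEq] at ht
      have e1 := (hC g).eq_of_append_eq a1 b1 ht.1
      have e2 := (hD g).eq_of_append_eq a2 b2 ht.2
      obtain rfl : m = m' := Prod.ext e1 e2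
      congr 1
      refine ih r' (g ++ [m]) (by simpa using h1) (by simpa using h2) (by simpa using hl) ?_
      exact Prod.ext (List.append_cancel_left ht.1) (List.append_cancel_left ht.2)

/-- The first `n` entries of a history, continued by empty messages. -/
def LinkHist.pad (n : ℕ) (h : LinkHist) : LinkHist := (h ++ List.replicate n ([], [])).take n

theorem LinkHist.pad_append_replicate (n k : ℕ) (h : LinkHist) :
    LinkHist.pad n (h ++ List.replicate k ([], [])) = h.pad n := by
  rw [pad, pad, List.append_assoc, List.replicate_append_replicate, List.take_append,
    List.take_append, List.take_replicate, List.take_replicate]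
  congr 2
  omega

theorem LinkHist.pad_of_le {n : ℕ} {h : LinkHist} (hn : n ≤ h.length) : h.pad n = h.take n := by
  rw [pad, List.take_append_of_le_length hn]

theorem LinkHist.transcript_pad {n : ℕ} {h : LinkHist} (hn : h.length ≤ n) :
    (h.pad n).transcript = h.transcript := by
  rw [pad, List.take_append, List.take_of_length_le hn, List.take_replicate]
  simp [transcript]

/-- Both laws have total mass 1, so a strict inequality anywhere would contradict the sums. It
spares the proof of the reverse inequality in `map_viewAt`. -/
theorem pmf_eq_of_le {α : Type*} {p q : PMF α} (h : ∀ a, p a ≤ q a) : p = q := by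
  by_contra hne
  obtain ⟨a, ha⟩ : ∃ a, p a ≠ q a := by
    by_contra! hall
    exact hne (PMF.ext hall)
  have := ENNReal.tsum_lt_tsum p.tsum_coe_ne_top h (lt_of_le_of_ne (h a) ha)
  rw [p.tsum_coe, q.tsum_coe] at this
  exact lt_irrefl _ this

theorem pmf_bind_congr {α β : Type*} {p : PMF α} {f g : α → PMF β}
    (h : ∀ a ∈ p.support, f a = g a) : p.bind f = p.bind g := by
  ext b
  rw [PMF.bind_apply, PMF.bind_apply]
  refine tsum_mul_congr fun a ha => ?_
  rw [h a ((p.mem_support_iff a).2 ha)]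

namespace Protocol

variable (P : Protocol 𝒳 𝒴 𝒵) (pXY : PMF (𝒳 × 𝒴))

variable {P pXY} in
theorem mem_support_stateLaw_succ {n : ℕ} {s : State 𝒳 𝒴} :
    s ∈ (P.stateLaw pXY (n + 1)).support ↔
      ∃ t ∈ (P.stateLaw pXY n).support, ∃ r ∈ (P.roundLaw t).support, t.append r = s := by
  rw [stateLaw, PMF.mem_support_bind_iff]
  simp only [PMF.support_map, Set.mem_image]

variable {P pXY} in
theorem length_rounds_of_mem_support {n : ℕ} {s : State 𝒳 𝒴}
    (hs : s ∈ (P.stateLaw pXY n).support) : s.rounds.length = n := by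
  induction n generalizing s with
  | zero =>
    rw [stateLaw, PMF.support_map] at hs
    obtain ⟨xy, -, rfl⟩ := hs
    rfl
  | succ n ih =>
    obtain ⟨t, ht, r, -, rfl⟩ := mem_support_stateLaw_succ.1 hs
    simp [State.append, ih ht]

variable {P pXY} in
/-- After a fixed number of rounds the transcript of a link determines its history. -/
theorem UsesPrefixFreeCodes.link_eq (h : P.UsesPrefixFreeCodes pXY) {n : ℕ} {s s' : State 𝒳 𝒴}
    (hs : s ∈ (P.stateLaw pXY n).support) (hs' : s' ∈ (P.stateLaw pXY n).support) :
    (s.link12.transcript = s'.link12.transcript → s.link12 = s'.link12) ∧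
      (s.link23.transcript = s'.link23.transcript → s.link23 = s'.link23) ∧
      (s.link31.transcript = s'.link31.transcript → s.link31 = s'.link31) := by
  obtain ⟨C12, C21, C23, C32, C31, C13, hpf, hC⟩ := h
  have key : ∀ (n : ℕ) (s : State 𝒳 𝒴), s ∈ (P.stateLaw pXY n).support →
      s.link12.Coded C12 C21 ∧ s.link23.Coded C23 C32 ∧ s.link31.Coded C31 C13 := by
    intro n
    induction n with
    | zero =>
      intro s hs
      rw [stateLaw, PMF.support_map] at hs
      obtain ⟨xy, -, rfl⟩ := hs
      exact ⟨LinkHist.coded_nil _ _, LinkHist.coded_nil _ _, LinkHist.coded_nil _ _⟩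
    | succ n ih =>
      intro s hs
      obtain ⟨t, ht, r, hr, rfl⟩ := mem_support_stateLaw_succ.1 hs
      obtain ⟨h1, h2, h3⟩ := ih t ht
      obtain ⟨c1, c2, c3, c4, c5, c6⟩ := hC n t ht r hr
      have e1 : (t.append r).link12 = t.link12 ++ [(r.m12, r.m21)] := by
        simp [State.append, State.link12]
      have e2 : (t.append r).link23 = t.link23 ++ [(r.m23, r.m32)] := by
        simp [State.append, State.link23]
      have e3 : (t.append r).link31 = t.link31 ++ [(r.m31, r.m13)] := by
        simp [State.append, State.link31]
      rw [e1, e2, e3]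
      exact ⟨h1.concat c1 c2, h2.concat c3 c4, h3.concat c5 c6⟩
  obtain ⟨h1, h2, h3⟩ := key n s hs
  obtain ⟨h1', h2', h3'⟩ := key n s' hs'
  have hl : s.rounds.length = s'.rounds.length :=
    (length_rounds_of_mem_support hs).trans (length_rounds_of_mem_support hs').symm
  refine ⟨h1.eq_of_transcript_eq (fun h => (hpf h).1) (fun h => (hpf h).2.1) h1' ?_,
    h2.eq_of_transcript_eq (fun h => (hpf h).2.2.1) (fun h => (hpf h).2.2.2.1) h2' ?_,
    h3.eq_of_transcript_eq (fun h => (hpf h).2.2.2.2.1) (fun h => (hpf h).2.2.2.2.2) h3' ?_⟩ <;>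
  simp [State.link12, State.link23, State.link31, hl]

/-! ### The view after `n` rounds as a function of the final transcripts -/

theorem wait_mem_support {n : ℕ} {s : State 𝒳 𝒴} (hs : s ∈ (P.stateLaw pXY n).support)
    (ht : P.Terminated s) (k : ℕ) : s.wait k ∈ (P.stateLaw pXY (n + k)).support := by
  induction k with
  | zero => simpa [State.wait] using hs
  | succ k ih =>
    rw [← add_assoc, mem_support_stateLaw_succ]
    refine ⟨s.wait k, ih, Round.silent, ?_, ?_⟩
    · rw [ht k, PMF.support_pure]
      rfl
    · simp [State.wait, State.append, List.replicate_succ']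

/-- The state `s` is a possible state in which `P` has terminated with inputs and final
transcripts `e`. -/
def Reaches (s : State 𝒳 𝒴) (e : Final 𝒳 𝒴) : Prop :=
  (∃ n, s ∈ (P.stateLaw pXY n).support) ∧ P.Terminated s ∧ s.final = e

theorem link12_wait (s : State 𝒳 𝒴) (k : ℕ) :
    (s.wait k).link12 = s.link12 ++ List.replicate k ([], []) := by
  simp [State.wait, State.link12, Round.silent]

theorem link23_wait (s : State 𝒳 𝒴) (k : ℕ) :
    (s.wait k).link23 = s.link23 ++ List.replicate k ([], []) := by
  simp [State.wait, State.link23, Round.silent]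

theorem link31_wait (s : State 𝒳 𝒴) (k : ℕ) :
    (s.wait k).link31 = s.link31 ++ List.replicate k ([], []) := by
  simp [State.wait, State.link31, Round.silent]

theorem transcript_append_replicate (h : LinkHist) (k : ℕ) :
    LinkHist.transcript (h ++ List.replicate k ([], [])) = h.transcript := by
  simp [LinkHist.transcript]

variable {P pXY} in
-- Each link is treated separately, so that the first n rounds of a link depend on the final
-- transcript of that link alone, regardless of the inputs and the other links.
theorem Reaches.pad_eq (h : P.UsesPrefixFreeCodes pXY) {s s' : State 𝒳 𝒴} {e e' : Final 𝒳 𝒴}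
    (hs : P.Reaches pXY s e) (hs' : P.Reaches pXY s' e') (n : ℕ) :
    (e.m12 = e'.m12 → s.link12.pad n = s'.link12.pad n) ∧
      (e.m23 = e'.m23 → s.link23.pad n = s'.link23.pad n) ∧
      (e.m31 = e'.m31 → s.link31.pad n = s'.link31.pad n) := by
  obtain ⟨⟨m, hm⟩, ht, rfl⟩ := hs
  obtain ⟨⟨m', hm'⟩, ht', rfl⟩ := hs'
  -- The two runs may terminate after different numbers of rounds; waiting brings both to m + m'
  -- rounds, where decoding applies.
  have h1 := P.wait_mem_support pXY hm ht m'
  have h2 := P.wait_mem_support pXY hm' ht' m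
  rw [add_comm] at h2
  obtain ⟨l1, l2, l3⟩ := h.link_eq h1 h2
  simp only [link12_wait, link23_wait, link31_wait, transcript_append_replicate] at l1 l2 l3
  refine ⟨fun he => ?_, fun he => ?_, fun he => ?_⟩
  · rw [← LinkHist.pad_append_replicate n m', l1 he, LinkHist.pad_append_replicate]
  · rw [← LinkHist.pad_append_replicate n m', l2 he, LinkHist.pad_append_replicate]
  · rw [← LinkHist.pad_append_replicate n m', l3 he, LinkHist.pad_append_replicate]

open Classical in
/-- A state in which `P` has terminated with the given inputs and final transcripts. -/
def finalState (e : Final 𝒳 𝒴) : State 𝒳 𝒴 :=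
  if h : ∃ s, P.Reaches pXY s e then h.choose else ⟨e.x, e.y, []⟩

/-- The view after `n` rounds, reconstructed from the final transcripts. -/
def viewAt (n : ℕ) (e : Final 𝒳 𝒴) : View 𝒳 𝒴 :=
  (e.x, e.y, (P.finalState pXY e).link12.pad n, (P.finalState pXY e).link23.pad n,
    (P.finalState pXY e).link31.pad n)

/-- The view after the first `n` rounds of a state. -/
def _root_.ThreeParty.State.viewTake (n : ℕ) (s : State 𝒳 𝒴) : View 𝒳 𝒴 :=
  (s.x, s.y, s.link12.take n, s.link23.take n, s.link31.take n)

/-- Later rounds append to the histories and leave the first n entries untouched. -/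
theorem map_viewTake {n m : ℕ} (h : n ≤ m) :
    (P.stateLaw pXY m).map (State.viewTake n) = P.viewLaw pXY n := by
  induction m, h using Nat.le_induction with
  | base =>
    rw [viewLaw, ← PMF.bind_pure_comp, ← PMF.bind_pure_comp]
    refine pmf_bind_congr fun s hs => ?_
    have hl := length_rounds_of_mem_support hs
    simp only [Function.comp_apply, State.viewTake, State.view]
    rw [List.take_of_length_le, List.take_of_length_le, List.take_of_length_le] <;>
    simp [State.link12, State.link23, State.link31, hl]
  | succ m hm ih =>
    rw [← ih, stateLaw, PMF.map_bind, ← PMF.bind_pure_comp]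
    refine pmf_bind_congr fun s hs => ?_
    have hl := length_rounds_of_mem_support hs
    rw [PMF.map_comp]
    have : State.viewTake n ∘ s.append = fun _ => State.viewTake n s := by
      funext r
      simp only [Function.comp_apply, State.viewTake, State.append, State.link12, State.link23,
        State.link31, List.map_append]
      rw [List.take_append_of_le_length, List.take_append_of_le_length,
        List.take_append_of_le_length] <;> simp [hl, hm]
    rw [this]
    exact PMF.map_const _ _

variable {P pXY} in
theorem exists_reaches {hT : P.Terminates pXY} {e : Final 𝒳 𝒴} (he : P.finalLaw pXY hT e ≠ 0) :
    ∃ s, P.Reaches pXY s e := by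
  have h1 : (⨆ n, P.finalMassAt pXY n e) ≠ 0 := he
  obtain ⟨n, hn⟩ : ∃ n, P.finalMassAt pXY n e ≠ 0 := by
    by_contra! hall
    simp [hall] at h1
  rw [finalMassAt, ne_eq, PMF.toOuterMeasure_apply_eq_zero_iff, Set.not_disjoint_iff] at hn
  obtain ⟨s, hs, ht, hf⟩ := hn
  exact ⟨s, ⟨n, hs⟩, ht, hf⟩

theorem reaches_finalState {hT : P.Terminates pXY} {e : Final 𝒳 𝒴}
    (he : P.finalLaw pXY hT e ≠ 0) : P.Reaches pXY (P.finalState pXY e) e := by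
  rw [finalState, dif_pos (exists_reaches he)]
  exact (exists_reaches he).choose_spec

/-- The arbitrary choice in `finalState` is immaterial: any two terminated states with the same
transcripts have the same padded histories, and with at least n rounds the padding is not used. -/
theorem viewAt_final (h : P.UsesPrefixFreeCodes pXY) {m n : ℕ} (hmn : n ≤ m) {s : State 𝒳 𝒴}
    (hs : s ∈ (P.stateLaw pXY m).support) (ht : P.Terminated s) :
    P.viewAt pXY n s.final = s.viewTake n := by
  have hr : P.Reaches pXY s s.final := ⟨⟨m, hs⟩, ht, rfl⟩
  have hr' : P.Reaches pXY (P.finalState pXY s.final) s.final := by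
    have hex : ∃ t, P.Reaches pXY t s.final := ⟨s, hr⟩
    rw [finalState, dif_pos hex]
    exact hex.choose_spec
  obtain ⟨h1, h2, h3⟩ := hr'.pad_eq h hr n
  have hl := length_rounds_of_mem_support hs
  rw [viewAt, h1 rfl, h2 rfl, h3 rfl, LinkHist.pad_of_le, LinkHist.pad_of_le, LinkHist.pad_of_le]
  · rfl
  all_goals simpa [State.link12, State.link23, State.link31, hl] using hmn

/-- The view reconstructed from the final transcripts has the law of the view. -/
theorem map_viewAt (h : P.UsesPrefixFreeCodes pXY) (hT : P.Terminates pXY) (n : ℕ) :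
    (P.finalLaw pXY hT).map (P.viewAt pXY n) = P.viewLaw pXY n := by
  classical
  refine pmf_eq_of_le fun w => ?_
  rw [map_apply_eq, ENNReal.tsum_eq_iSup_sum]
  refine iSup_le fun F => ?_
  have e1 : ∀ e, (if P.viewAt pXY n e = w then P.finalLaw pXY hT e else 0) =
      ⨆ m, if P.viewAt pXY n e = w then P.finalMassAt pXY m e else 0 := by
    intro e
    by_cases he : P.viewAt pXY n e = w
    · simp only [if_pos he]
      rfl
    · simp [if_neg he]
  simp only [e1]
  have hmono : ∀ e, Monotone fun m =>
      if P.viewAt pXY n e = w then P.finalMassAt pXY m e else 0 := by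
    intro e a b hab
    by_cases he : P.viewAt pXY n e = w
    · simpa only [if_pos he] using P.finalMassAt_mono pXY e hab
    · simp [if_neg he]
  rw [ENNReal.finsetSum_iSup_of_monotone hmono]
  refine iSup_le fun m => ?_
  -- The number of rounds is raised to at least n, so that terminated states contain the whole view
  -- after n rounds. Their mass is then bounded by that of all states with this view, terminated or
  -- not.
  refine (Finset.sum_le_sum fun e _ => hmono e (le_max_left m n)).trans ?_
  refine (ENNReal.sum_le_tsum F).trans ?_
  rw [← P.map_viewTake pXY (le_max_right m n), map_apply_eq]
  calc _ = ∑' e, ∑' s, if P.Terminated s ∧ s.final = e ∧ P.viewAt pXY n e = w then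
        P.stateLaw pXY (max m n) s else 0 := by
        refine tsum_congr fun e => ?_
        by_cases he : P.viewAt pXY n e = w
        · dsimp only
          rw [if_pos he, finalMassAt, PMF.toOuterMeasure_apply]
          refine tsum_congr fun s => ?_
          simp [Set.indicator_apply, he]
        · simp [he]
    _ = ∑' s, ∑' e, if P.Terminated s ∧ s.final = e ∧ P.viewAt pXY n e = w then
        P.stateLaw pXY (max m n) s else 0 := ENNReal.tsum_comm
    _ ≤ _ := by
        refine ENNReal.tsum_le_tsum fun s => ?_
        rw [tsum_eq_single s.final fun e he => if_neg fun h' => he h'.2.1.symm]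
        by_cases hs : P.stateLaw pXY (max m n) s = 0
        · simp [hs]
        by_cases ht : P.Terminated s
        · rw [P.viewAt_final pXY h (le_max_right m n) ((PMF.mem_support_iff _ _).2 hs) ht]
          simp [ht]
        · simp [ht]

end Protocol

end Coupling
end ThreeParty

namespace ThreeParty

section Markov

variable {Ω Ω' α β γ δ ζ β' : Type*}

/-! ### Markov chains under images, limits and independent randomization -/

theorem isMarkovChain_map (μ : PMF Ω) (f : Ω → Ω') (T : Ω' → α) (U : Ω' → β) (V : Ω' → γ) :
    IsMarkovChain (μ.map f) T U V ↔
      IsMarkovChain μ (fun ω => T (f ω)) (fun ω => U (f ω)) fun ω => V (f ω) := by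
  simp only [IsMarkovChain, PMF.map_comp]
  rfl

theorem map_apply_congr {μ : PMF Ω} {X : Ω → α} {Y : Ω → β} {a : α} {b : β}
    (h : ∀ ω, μ ω ≠ 0 → (X ω = a ↔ Y ω = b)) : μ.map X a = μ.map Y b := by
  classical
  rw [map_apply_eq, map_apply_eq]
  refine tsum_congr fun ω => ?_
  by_cases h0 : μ ω = 0
  · simp [h0]
  · exact if_congr (h ω h0) rfl rfl

/-- The middle term matters only through the partition it induces on the support; values outside its
range contribute 0 = 0. It serves to replace histories by transcripts and to reorder pairs. -/
theorem IsMarkovChain.congr_middle {μ : PMF Ω} {T : Ω → α} {U : Ω → β} {V : Ω → γ}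
    (h : IsMarkovChain μ T U V) {U' : Ω → β'}
    (hU : ∀ ω ω', μ ω ≠ 0 → μ ω' ≠ 0 → (U ω' = U ω ↔ U' ω' = U' ω)) :
    IsMarkovChain μ T U' V := by
  classical
  intro t u v
  by_cases hu : ∃ ω, μ ω ≠ 0 ∧ U' ω = u
  · obtain ⟨ω, hω, rfl⟩ := hu
    have e1 : μ.map (fun ω => (T ω, U' ω, V ω)) (t, U' ω, v) =
        μ.map (fun ω => (T ω, U ω, V ω)) (t, U ω, v) := map_apply_congr fun ω' h0 => by
      simp only [Prod.mk.injEq, hU ω ω' hω h0]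
    have e2 : μ.map U' (U' ω) = μ.map U (U ω) := map_apply_congr fun ω' h0 =>
      (hU ω ω' hω h0).symm
    have e3 : μ.map (fun ω => (T ω, U' ω)) (t, U' ω) = μ.map (fun ω => (T ω, U ω)) (t, U ω) :=
      map_apply_congr fun ω' h0 => by simp only [Prod.mk.injEq, hU ω ω' hω h0]
    have e4 : μ.map (fun ω => (U' ω, V ω)) (U' ω, v) = μ.map (fun ω => (U ω, V ω)) (U ω, v) :=
      map_apply_congr fun ω' h0 => by simp only [Prod.mk.injEq, hU ω ω' hω h0]
    rw [e1, e2, e3, e4]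
    exact h t (U ω) v
  · push Not at hu
    have h1 : μ.map U' u = 0 := by
      rw [map_apply_eq, ENNReal.tsum_eq_zero]
      intro ω
      by_cases h0 : μ ω = 0
      · simp [h0]
      · rw [if_neg (hu ω h0)]
    have h2 : μ.map (fun ω => (U' ω, V ω)) (u, v) = 0 := by
      rw [map_apply_eq, ENNReal.tsum_eq_zero]
      intro ω
      by_cases h0 : μ ω = 0
      · simp [h0]
      · rw [if_neg fun h => hu ω h0 (Prod.mk.inj h).1]
    rw [h1, h2, mul_zero, mul_zero]

/-- The defining identity involves four point probabilities, each of which converges when the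
variables are eventually constant at every point of the support. -/
theorem isMarkovChain_of_tendsto {μ : PMF Ω} {T : Ω → α} {U : Ω → β} {V : Ω → γ}
    {U' : ℕ → Ω → β} {V' : ℕ → Ω → γ} (h : ∀ n, IsMarkovChain μ T (U' n) (V' n))
    (hU : ∀ ω, μ ω ≠ 0 → ∀ᶠ n in Filter.atTop, U' n ω = U ω)
    (hV : ∀ ω, μ ω ≠ 0 → ∀ᶠ n in Filter.atTop, V' n ω = V ω) : IsMarkovChain μ T U V := by
  intro t u v
  have l1 : Filter.Tendsto (fun n => μ.map (fun ω => (T ω, U' n ω, V' n ω)) (t, u, v)) Filter.atTop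
      (nhds (μ.map (fun ω => (T ω, U ω, V ω)) (t, u, v))) :=
    tendsto_map_apply (fun ω hω => by
      filter_upwards [hU ω hω, hV ω hω] with n h1 h2
      rw [h1, h2]) _
  have l2 : Filter.Tendsto (fun n => μ.map (U' n) u) Filter.atTop (nhds (μ.map U u)) :=
    tendsto_map_apply hU _
  have l3 : Filter.Tendsto (fun n => μ.map (fun ω => (T ω, U' n ω)) (t, u)) Filter.atTop
      (nhds (μ.map (fun ω => (T ω, U ω)) (t, u))) :=
    tendsto_map_apply (fun ω hω => by
      filter_upwards [hU ω hω] with n h1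
      rw [h1]) _
  have l4 : Filter.Tendsto (fun n => μ.map (fun ω => (U' n ω, V' n ω)) (u, v)) Filter.atTop
      (nhds (μ.map (fun ω => (U ω, V ω)) (u, v))) :=
    tendsto_map_apply (fun ω hω => by
      filter_upwards [hU ω hω, hV ω hω] with n h1 h2
      rw [h1, h2]) _
  have l12 := ENNReal.Tendsto.mul l1 (Or.inr (PMF.apply_ne_top _ _)) l2
    (Or.inr (PMF.apply_ne_top _ _))
  have l34 := ENNReal.Tendsto.mul l3 (Or.inr (PMF.apply_ne_top _ _)) l4
    (Or.inr (PMF.apply_ne_top _ _))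
  exact tendsto_nhds_unique l12 (l34.congr fun n => (h n t u v).symm)

theorem map_bind_pair_apply (μ : PMF Ω) (S : Ω → δ) (k : δ → PMF ζ)
    (s : δ) (z : ζ) :
    (μ.bind fun ω => (k (S ω)).map fun z => (ω, z)).map (fun w => (S w.1, w.2)) (s, z) =
      μ.map S s * k s z := by
  have e : (μ.bind fun ω => (k (S ω)).map fun z => (ω, z)).map (fun w => (S w.1, w.2)) =
      (μ.map S).bind fun s => (k s).map fun z => (s, z) := by
    simp only [PMF.map_bind, PMF.map_comp, PMF.bind_map]
    rfl
  rw [e, bind_map_pair_apply]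

/-- A Markov chain `T - U - V` remains one if `V` is extended by a randomized function of
`(U, V)`. -/
theorem IsMarkovChain.randomize {μ : PMF Ω} {T : Ω → α} {U : Ω → β} {V : Ω → γ}
    (h : IsMarkovChain μ T U V) (k : β → γ → PMF ζ) :
    IsMarkovChain (μ.bind fun ω => (k (U ω) (V ω)).map fun z => (ω, z)) (fun w => T w.1)
      (fun w => U w.1) fun w => (V w.1, w.2) := by
  classical
  rintro t u ⟨v, z⟩
  have e1 := map_bind_pair_apply μ (fun ω => (T ω, U ω, V ω)) (fun s => k s.2.1 s.2.2) (t, u, v) z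
  have e2 := map_bind_pair_apply μ (fun ω => (U ω, V ω)) (fun s => k s.1 s.2) (u, v) z
  dsimp only at e1 e2
  set ν := μ.bind fun ω => (k (U ω) (V ω)).map fun z => (ω, z) with hν
  have hfst : ν.map Prod.fst = μ := by
    simp only [hν, PMF.map_bind, PMF.map_comp]
    have : ∀ ω : Ω, (k (U ω) (V ω)).map (Prod.fst ∘ fun z => (ω, z)) = PMF.pure ω :=
      fun ω => PMF.map_const _ ω
    simp only [this, PMF.bind_pure]
  have e3 : ν.map (fun w => U w.1) = μ.map U := by
    rw [← hfst, PMF.map_comp]; rfl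
  have e4 : ν.map (fun w => (T w.1, U w.1)) = μ.map fun ω => (T ω, U ω) := by
    rw [← hfst, PMF.map_comp]; rfl
  have e5 : ν.map (fun w => (T w.1, U w.1, V w.1, w.2)) (t, u, v, z) =
      ν.map (fun w => ((T w.1, U w.1, V w.1), w.2)) ((t, u, v), z) := by
    rw [map_apply_eq, map_apply_eq]
    exact tsum_congr fun w => if_congr (by simp only [Prod.mk.injEq]; tauto) rfl rfl
  have e6 : ν.map (fun w => (U w.1, V w.1, w.2)) (u, v, z) =
      ν.map (fun w => ((U w.1, V w.1), w.2)) ((u, v), z) := by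
    rw [map_apply_eq, map_apply_eq]
    exact tsum_congr fun w => if_congr (by simp only [Prod.mk.injEq]; tauto) rfl rfl
  rw [e3, e4, e5, e6, e1, e2, mul_right_comm, h t u v]
  ring

theorem isMarkovChain_unit (μ : PMF Ω) (T : Ω → α) (U : Ω → β) :
    IsMarkovChain μ T U fun _ => () := by
  classical
  intro t u v
  have e1 : μ.map (fun ω => (T ω, U ω, ())) (t, u, v) = μ.map (fun ω => (T ω, U ω)) (t, u) := by
    rw [map_apply_eq, map_apply_eq]
    exact tsum_congr fun w => if_congr (by simp) rfl rfl
  have e2 : μ.map (fun ω => (U ω, ())) (u, v) = μ.map U u := by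
    rw [map_apply_eq, map_apply_eq]
    exact tsum_congr fun w => if_congr (by simp) rfl rfl
  rw [e1, e2]

end Markov

section Secure

variable {𝒳 𝒴 𝒵 : Type*}

/-! ### The law of the outcome -/

/-- The inputs and the final transcripts of an outcome. -/
def Outcome.final (o : Outcome 𝒳 𝒴 𝒵) : Final 𝒳 𝒴 := ⟨o.x, o.y, o.m12, o.m23, o.m31⟩

/-- The outcome with the given inputs, transcripts and output. -/
def Final.outcome (w : Final 𝒳 𝒴 × 𝒵) : Outcome 𝒳 𝒴 𝒵 :=
  ⟨w.1.x, w.1.y, w.2, w.1.m12, w.1.m23, w.1.m31⟩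

namespace Protocol

variable (P : Protocol 𝒳 𝒴 𝒵) (pXY : PMF (𝒳 × 𝒴))

theorem outcomeLaw_eq (h : P.Terminates pXY) : P.outcomeLaw pXY h =
    ((P.finalLaw pXY h).bind fun e => (P.output e.m23 e.m31).map fun z => (e, z)).map
      Final.outcome := by
  simp only [outcomeLaw, PMF.map_bind, PMF.map_comp]
  rfl

theorem outcomeLaw_map_final (h : P.Terminates pXY) :
    (P.outcomeLaw pXY h).map Outcome.final = P.finalLaw pXY h := by
  simp only [outcomeLaw, PMF.map_bind, PMF.map_comp]
  have : ∀ e : Final 𝒳 𝒴, (P.output e.m23 e.m31).map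
      (Outcome.final ∘ fun z => ⟨e.x, e.y, z, e.m12, e.m23, e.m31⟩) = PMF.pure e :=
    fun e => PMF.map_const _ e
  simp only [this, PMF.bind_pure]

theorem final_mem_support {h : P.Terminates pXY} {o : Outcome 𝒳 𝒴 𝒵}
    (ho : P.outcomeLaw pXY h o ≠ 0) : P.finalLaw pXY h o.final ≠ 0 := by
  rw [← outcomeLaw_map_final]
  exact map_apply_ne_zero ho _

variable {P pXY} in
/-- The histories in the views of possible final states are determined by their transcripts. -/
theorem viewAt_eq_iff (h : P.UsesPrefixFreeCodes pXY) {hT : P.Terminates pXY} (n : ℕ)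
    {e e' : Final 𝒳 𝒴} (he : P.finalLaw pXY hT e ≠ 0) (he' : P.finalLaw pXY hT e' ≠ 0) :
    ((P.viewAt pXY n e').2.2.1 = (P.viewAt pXY n e).2.2.1 ↔
        (P.viewAt pXY n e').2.2.1.transcript = (P.viewAt pXY n e).2.2.1.transcript) ∧
      ((P.viewAt pXY n e').2.2.2.1 = (P.viewAt pXY n e).2.2.2.1 ↔
        (P.viewAt pXY n e').2.2.2.1.transcript = (P.viewAt pXY n e).2.2.2.1.transcript) ∧
      ((P.viewAt pXY n e').2.2.2.2 = (P.viewAt pXY n e).2.2.2.2 ↔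
        (P.viewAt pXY n e').2.2.2.2.transcript = (P.viewAt pXY n e).2.2.2.2.transcript) := by
  have key : ∀ e, P.finalLaw pXY hT e ≠ 0 →
      ∃ s ∈ (P.stateLaw pXY n).support, s.view = P.viewAt pXY n e := by
    intro e he
    have := map_apply_ne_zero he (P.viewAt pXY n)
    rw [map_viewAt P pXY h hT, viewLaw, ← PMF.mem_support_iff, PMF.support_map] at this
    exact this
  obtain ⟨s, hs, h1⟩ := key e he
  obtain ⟨s', hs', h2⟩ := key e' he'
  rw [← h1, ← h2]
  obtain ⟨l1, l2, l3⟩ := h.link_eq hs' hs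
  exact ⟨⟨congrArg _, l1⟩, ⟨congrArg _, l2⟩, ⟨congrArg _, l3⟩⟩

variable {P pXY} in
-- Once n is at least the length of the chosen terminated run, padding adds only empty messages. The
-- threshold depends on the outcome, hence pointwise limits.
theorem eventually_transcript_viewAt {hT : P.Terminates pXY} {e : Final 𝒳 𝒴}
    (he : P.finalLaw pXY hT e ≠ 0) : ∀ᶠ n in Filter.atTop,
      (P.viewAt pXY n e).2.2.1.transcript = e.m12 ∧
      (P.viewAt pXY n e).2.2.2.1.transcript = e.m23 ∧
      (P.viewAt pXY n e).2.2.2.2.transcript = e.m31 := by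
  obtain ⟨-, -, hf⟩ := P.reaches_finalState pXY he
  filter_upwards [Filter.eventually_ge_atTop (P.finalState pXY e).rounds.length] with n hn
  simp only [viewAt]
  rw [LinkHist.transcript_pad, LinkHist.transcript_pad, LinkHist.transcript_pad]
  · exact ⟨congrArg Final.m12 hf, congrArg Final.m23 hf, congrArg Final.m31 hf⟩
  all_goals simpa [State.link12, State.link23, State.link31] using hn

/-- The chain for histories after n rounds is pulled back to the final law, restated for
transcripts, which carry the same information for fixed n, and passed to the limit. -/
theorem isMarkovChain_final_alice {pX : PMF 𝒳} {pY : PMF 𝒴}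
    (h : P.UsesPrefixFreeCodes (prodLaw pX pY)) (hT : P.Terminates (prodLaw pX pY)) :
    IsMarkovChain (P.finalLaw (prodLaw pX pY) hT) Final.x (fun e => (e.m31, e.m12))
      fun e => (e.m23, e.y) := by
  refine isMarkovChain_of_tendsto
    (U' := fun n e => ((P.viewAt (prodLaw pX pY) n e).2.2.2.2.transcript,
      (P.viewAt (prodLaw pX pY) n e).2.2.1.transcript))
    (V' := fun n e => ((P.viewAt (prodLaw pX pY) n e).2.2.2.1.transcript, e.y))
    (fun n => ?_) (fun e he => ?_) fun e he => ?_
  · have hM := P.isMarkovChain_alice pX pY n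
    rw [← P.map_viewAt _ h hT, isMarkovChain_map] at hM
    refine (hM.congr_middle fun e e' he he' => ?_).map_right fun v => (v.2.transcript, v.1)
    obtain ⟨h1, -, h3⟩ := viewAt_eq_iff h n he he'
    simp only [Prod.mk.injEq, h1, h3]
    exact and_comm
  · filter_upwards [eventually_transcript_viewAt he] with n hn
    rw [hn.1, hn.2.2]
  · filter_upwards [eventually_transcript_viewAt he] with n hn
    rw [hn.2.1]

theorem isMarkovChain_final_bob {pX : PMF 𝒳} {pY : PMF 𝒴}
    (h : P.UsesPrefixFreeCodes (prodLaw pX pY)) (hT : P.Terminates (prodLaw pX pY)) :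
    IsMarkovChain (P.finalLaw (prodLaw pX pY) hT) Final.y (fun e => (e.m23, e.m12))
      fun e => (e.m31, e.x) := by
  refine isMarkovChain_of_tendsto
    (U' := fun n e => ((P.viewAt (prodLaw pX pY) n e).2.2.2.1.transcript,
      (P.viewAt (prodLaw pX pY) n e).2.2.1.transcript))
    (V' := fun n e => ((P.viewAt (prodLaw pX pY) n e).2.2.2.2.transcript, e.x))
    (fun n => ?_) (fun e he => ?_) fun e he => ?_
  · have hM := P.isMarkovChain_bob pX pY n
    rw [← P.map_viewAt _ h hT, isMarkovChain_map] at hM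
    refine (hM.congr_middle fun e e' he he' => ?_).map_right fun v => (v.2.transcript, v.1)
    obtain ⟨h1, h2, -⟩ := viewAt_eq_iff h n he he'
    simp only [Prod.mk.injEq, h1, h2]
    exact and_comm
  · filter_upwards [eventually_transcript_viewAt he] with n hn
    rw [hn.1, hn.2.1]
  · filter_upwards [eventually_transcript_viewAt he] with n hn
    rw [hn.2.2]

/-- Charlie's output is drawn from M₂₃, which is on the far side of the chain, and M₃₁, which is in
the middle; it can therefore be adjoined to the far side. -/
theorem isMarkovChain_outcome_alice {pX : PMF 𝒳} {pY : PMF 𝒴}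
    (h : P.UsesPrefixFreeCodes (prodLaw pX pY)) (hT : P.Terminates (prodLaw pX pY)) :
    IsMarkovChain (P.outcomeLaw (prodLaw pX pY) hT) Outcome.x Outcome.m1 fun o => (o.y, o.z) := by
  have h1 := (P.isMarkovChain_final_alice h hT).randomize fun u v => P.output v.1 u.1
  rw [outcomeLaw_eq, isMarkovChain_map]
  refine (h1.map_right fun v => (v.1.2, v.2)).congr_middle fun w w' _ _ => ?_
  simp only [Final.outcome, Outcome.m1, Prod.mk.injEq]
  exact and_comm

theorem isMarkovChain_outcome_bob {pX : PMF 𝒳} {pY : PMF 𝒴}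
    (h : P.UsesPrefixFreeCodes (prodLaw pX pY)) (hT : P.Terminates (prodLaw pX pY)) :
    IsMarkovChain (P.outcomeLaw (prodLaw pX pY) hT) Outcome.y Outcome.m2 fun o => (o.x, o.z) := by
  have h1 := (P.isMarkovChain_final_bob h hT).randomize fun u v => P.output u.1 v.1
  rw [outcomeLaw_eq, isMarkovChain_map]
  refine (h1.map_right fun v => (v.1.2, v.2)).congr_middle fun w w' _ _ => ?_
  simp only [Final.outcome, Outcome.m2, Prod.mk.injEq]
  exact and_comm

/-- The output is a randomized function of M₃ alone, so the trivial chain (X, Y) - M₃ - const,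
randomized, gives the claim for any input law. -/
theorem isMarkovChain_outcome_charlie (hT : P.Terminates pXY) :
    IsMarkovChain (P.outcomeLaw pXY hT) Outcome.z Outcome.m3 fun o => (o.x, o.y) := by
  have h1 := (isMarkovChain_unit (P.finalLaw pXY hT) (fun e => (e.x, e.y))
    fun e => (e.m23, e.m31)).randomize fun u _ => P.output u.1 u.2
  rw [outcomeLaw_eq, isMarkovChain_map]
  exact (h1.map_right Prod.snd).symm

end Protocol

/-! ### Inputs and output are determined by the transcripts -/

theorem targetLaw_apply (pX : PMF 𝒳) (pY : PMF 𝒴) (W : 𝒳 → 𝒴 → PMF 𝒵) (x : 𝒳) (y : 𝒴) (z : 𝒵) :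
    targetLaw (prodLaw pX pY) W (x, y, z) = pX x * pY y * W x y z := by
  classical
  have e : targetLaw (prodLaw pX pY) W =
      ((prodLaw pX pY).bind fun xy => (W xy.1 xy.2).map fun z => (xy, z)).map
        fun w => (w.1.1, w.1.2, w.2) := by
    simp only [targetLaw, PMF.map_bind, PMF.map_comp]
    rfl
  rw [e, map_apply_eq, tsum_eq_single ((x, y), z), if_pos rfl, bind_map_pair_apply, prodLaw,
    bind_map_pair_apply]
  rintro ⟨⟨x', y'⟩, z'⟩ h
  rw [if_neg]
  simp only [Prod.mk.injEq]
  rintro ⟨rfl, rfl, rfl⟩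
  exact h rfl

section Determined

variable {pX : PMF 𝒳} {pY : PMF 𝒴} {W : 𝒳 → 𝒴 → PMF 𝒵} {P : Protocol 𝒳 𝒴 𝒵}

/-- Both conditional laws of V, given U at ω and at ω', equal the conditional law given the common
value of T. -/
theorem double_markov_eq {Ω α β γ : Type*} {μ : PMF Ω} {T : Ω → α} {U : Ω → β} {V : Ω → γ}
    (h : IsMarkovChain μ T U V) (h' : IsMarkovChain μ U T V) {ω ω' : Ω} (hω : μ ω ≠ 0)
    (hω' : μ ω' ≠ 0) (hT : T ω' = T ω) (v : γ) :
    μ.map (joint U V) (U ω, v) * μ.map U (U ω') = μ.map (joint U V) (U ω', v) * μ.map U (U ω) := by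
  have h1 := double_markov h h' hω v
  have h2 := double_markov h h' hω' v
  rw [hT] at h2
  refine (ENNReal.mul_left_inj (map_apply_ne_zero hω T) (map_apply_ne_top _ _ _)).1 ?_
  rw [mul_right_comm, h1, mul_right_comm _ _ (μ.map T (T ω)), h2]
  ring

theorem Protocol.IsSecure.map_x_yz (hP : P.IsSecure (prodLaw pX pY) W) (x : 𝒳) (y : 𝒴) (z : 𝒵) :
    (P.outcomeLaw (prodLaw pX pY) hP.terminates).map (joint Outcome.x fun o => (o.y, o.z))
      (x, (y, z)) = pX x * pY y * W x y z := by
  rw [← targetLaw_apply, ← hP.correct]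

theorem Protocol.IsSecure.map_y_xz (hP : P.IsSecure (prodLaw pX pY) W) (x : 𝒳) (y : 𝒴) (z : 𝒵) :
    (P.outcomeLaw (prodLaw pX pY) hP.terminates).map (joint Outcome.y fun o => (o.x, o.z))
      (y, (x, z)) = pX x * pY y * W x y z := by
  classical
  rw [← hP.map_x_yz, map_apply_eq, map_apply_eq]
  exact tsum_congr fun w => if_congr (by simp only [Prod.mk.injEq]; tauto) rfl rfl

theorem Protocol.IsSecure.map_z_xy (hP : P.IsSecure (prodLaw pX pY) W) (x : 𝒳) (y : 𝒴) (z : 𝒵) :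
    (P.outcomeLaw (prodLaw pX pY) hP.terminates).map (joint Outcome.z fun o => (o.x, o.y))
      (z, (x, y)) = pX x * pY y * W x y z := by
  classical
  rw [← hP.map_x_yz, map_apply_eq, map_apply_eq]
  exact tsum_congr fun w => if_congr (by simp only [Prod.mk.injEq]; tauto) rfl rfl

theorem Protocol.IsSecure.map_x (hP : P.IsSecure (prodLaw pX pY) W) (x : 𝒳) :
    (P.outcomeLaw (prodLaw pX pY) hP.terminates).map Outcome.x x = pX x := by
  rw [← tsum_map_pair_right _ _ fun o => (o.y, o.z), ENNReal.tsum_prod']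
  simp only [hP.map_x_yz, ENNReal.tsum_mul_left, PMF.tsum_coe, mul_one]

theorem Protocol.IsSecure.map_y (hP : P.IsSecure (prodLaw pX pY) W) (y : 𝒴) :
    (P.outcomeLaw (prodLaw pX pY) hP.terminates).map Outcome.y y = pY y := by
  rw [← tsum_map_pair_right _ _ fun o => (o.x, o.z), ENNReal.tsum_prod']
  simp only [hP.map_y_xz, ENNReal.tsum_mul_left, ENNReal.tsum_mul_right, PMF.tsum_coe, mul_one,
    one_mul]

variable (hX : ∀ x, 0 < pX x) (hY : ∀ y, 0 < pY y) (hW : NormalForm W)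
  (hP : P.IsSecure (prodLaw pX pY) W)

include hX hY hW

/-- Privacy and the protocol structure give opposite Markov chains, so p(y, z | x) is determined by
m₁. It equals p(y) p(z | x, y); dividing by p(y) > 0 shows that the two inputs are equivalent. -/
theorem Protocol.IsSecure.x_eq_of_m1_eq {o o' : Outcome 𝒳 𝒴 𝒵}
    (ho : P.outcomeLaw (prodLaw pX pY) hP.terminates o ≠ 0)
    (ho' : P.outcomeLaw (prodLaw pX pY) hP.terminates o' ≠ 0) (h : o'.m1 = o.m1) : o'.x = o.x := by
  refine hW.left _ _ fun y z => ?_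
  have e := double_markov_eq hP.private_alice
    (P.isMarkovChain_outcome_alice hP.prefixFree hP.terminates) ho ho' h (y, z)
  rw [hP.map_x_yz, hP.map_x_yz, hP.map_x, hP.map_x] at e
  have h0 : pX o.x * pX o'.x * pY y ≠ 0 :=
    mul_ne_zero (mul_ne_zero (hX _).ne' (hX _).ne') (hY _).ne'
  have h1 : pX o.x * pX o'.x * pY y ≠ ∞ := ENNReal.mul_ne_top
    (ENNReal.mul_ne_top (PMF.apply_ne_top _ _) (PMF.apply_ne_top _ _)) (PMF.apply_ne_top _ _)
  refine (ENNReal.mul_right_inj h0 h1).1 ?_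
  calc _ = pX o'.x * pY y * W o'.x y z * pX o.x := by ring
    _ = pX o.x * pY y * W o.x y z * pX o'.x := e.symm
    _ = _ := by ring

theorem Protocol.IsSecure.y_eq_of_m2_eq {o o' : Outcome 𝒳 𝒴 𝒵}
    (ho : P.outcomeLaw (prodLaw pX pY) hP.terminates o ≠ 0)
    (ho' : P.outcomeLaw (prodLaw pX pY) hP.terminates o' ≠ 0) (h : o'.m2 = o.m2) : o'.y = o.y := by
  refine hW.right _ _ fun x z => ?_
  have e := double_markov_eq hP.private_bob
    (P.isMarkovChain_outcome_bob hP.prefixFree hP.terminates) ho ho' h (x, z)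
  rw [hP.map_y_xz, hP.map_y_xz, hP.map_y, hP.map_y] at e
  have h0 : pY o.y * pY o'.y * pX x ≠ 0 :=
    mul_ne_zero (mul_ne_zero (hY _).ne' (hY _).ne') (hX _).ne'
  have h1 : pY o.y * pY o'.y * pX x ≠ ∞ := ENNReal.mul_ne_top
    (ENNReal.mul_ne_top (PMF.apply_ne_top _ _) (PMF.apply_ne_top _ _)) (PMF.apply_ne_top _ _)
  refine (ENNReal.mul_right_inj h0 h1).1 ?_
  calc _ = pX x * pY o'.y * W x o'.y z * pY o.y := by ring
    _ = pX x * pY o.y * W x o.y z * pY o'.y := e.symm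
    _ = _ := by ring

/-- Here p(x, y | z) is determined by m₃. By Bayes' rule this fixes p(z | x, y) up to the factor
p(z), which is why equivalence of outputs is proportionality, with the ratio of the two output
probabilities as its constant. -/
theorem Protocol.IsSecure.z_eq_of_m3_eq {o o' : Outcome 𝒳 𝒴 𝒵}
    (ho : P.outcomeLaw (prodLaw pX pY) hP.terminates o ≠ 0)
    (ho' : P.outcomeLaw (prodLaw pX pY) hP.terminates o' ≠ 0) (h : o'.m3 = o.m3) : o'.z = o.z := by
  set ν := P.outcomeLaw (prodLaw pX pY) hP.terminates
  refine hW.output _ _ ⟨(ν.map Outcome.z o'.z).toReal / (ν.map Outcome.z o.z).toReal,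
    fun x y => ?_⟩
  have e := double_markov_eq hP.private_charlie
    (P.isMarkovChain_outcome_charlie _ hP.terminates) ho ho' h (x, y)
  rw [hP.map_z_xy, hP.map_z_xy] at e
  have h0 : pX x * pY y ≠ 0 := mul_ne_zero (hX _).ne' (hY _).ne'
  have h1 : pX x * pY y ≠ ∞ := ENNReal.mul_ne_top (PMF.apply_ne_top _ _) (PMF.apply_ne_top _ _)
  rw [mul_assoc, mul_assoc _ _ (ν.map Outcome.z o.z), ENNReal.mul_right_inj h0 h1] at e
  have e' := congrArg ENNReal.toReal e
  rw [ENNReal.toReal_mul, ENNReal.toReal_mul] at e'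
  have hz : 0 < (ν.map Outcome.z o.z).toReal :=
    ENNReal.toReal_pos (map_apply_ne_zero ho _) (map_apply_ne_top _ _ _)
  rw [div_mul_eq_mul_div, eq_div_iff hz.ne', ← e', mul_comm]

end Determined

end Secure
end ThreeParty

namespace ThreeParty

/-! ### The interaction inequality for the final transcripts of a secure protocol -/

section Main

variable {𝒳 𝒴 𝒵 : Type*} [Fintype 𝒳] [Fintype 𝒴]

/-- In a secure protocol with independent inputs, `H(X | M₃₁) + H(Y | M₂₃) + H(X, Y | M₂₃, M₃₁)`
is at most `H(M₁₂) + H(X | M₂₃, M₃₁) + H(Y | M₂₃, M₃₁)`. -/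
theorem Protocol.IsSecure.condEnt_add_le_ent_m12 {pX : PMF 𝒳} {pY : PMF 𝒴}
    {W : 𝒳 → 𝒴 → PMF 𝒵} {P : Protocol 𝒳 𝒴 𝒵} (hX : ∀ x, 0 < pX x) (hY : ∀ y, 0 < pY y)
    (hW : NormalForm W) (hP : P.IsSecure (prodLaw pX pY) W) {ν : PMF (Outcome 𝒳 𝒴 𝒵)}
    (hν : ν = P.outcomeLaw (prodLaw pX pY) hP.terminates) :
    condEnt ν Outcome.x Outcome.m31 + condEnt ν Outcome.y Outcome.m23 +
        condEnt ν (joint Outcome.x Outcome.y) (joint Outcome.m23 Outcome.m31) ≤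
      ent ν Outcome.m12 + (condEnt ν Outcome.x (joint Outcome.m23 Outcome.m31) +
        condEnt ν Outcome.y (joint Outcome.m23 Outcome.m31)) := by
  subst hν
  have hfin {o : Outcome 𝒳 𝒴 𝒵} (ho : P.outcomeLaw (prodLaw pX pY) hP.terminates o ≠ 0) :
    P.finalLaw (prodLaw pX pY) hP.terminates o.final ≠ 0 := P.final_mem_support _ ho
  have hpad {o o' : Outcome 𝒳 𝒴 𝒵} (ho : P.outcomeLaw (prodLaw pX pY) hP.terminates o ≠ 0)
      (ho' : P.outcomeLaw (prodLaw pX pY) hP.terminates o' ≠ 0) (n : ℕ) :=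
    (P.reaches_finalState _ (hfin ho')).pad_eq hP.prefixFree (P.reaches_finalState _ (hfin ho)) n
  refine le_ent_of_nonnegInteraction
    (A' := fun n o => (P.viewAt (prodLaw pX pY) n o.final).2.2.1.transcript)
    (B' := fun n o => (P.viewAt (prodLaw pX pY) n o.final).2.2.2.1.transcript)
    (C' := fun n o => (P.viewAt (prodLaw pX pY) n o.final).2.2.2.2.transcript)
    (fun n o o' ho ho' h => by
      exact congrArg LinkHist.transcript ((hpad ho ho' n).1 h))
    (fun n o o' ho ho' h => by
      exact congrArg LinkHist.transcript ((hpad ho ho' n).2.1 h))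
    (fun n o o' ho ho' h => by
      exact congrArg LinkHist.transcript ((hpad ho ho' n).2.2 h))
    (fun o ho => (Protocol.eventually_transcript_viewAt (hfin ho)).mono fun n h => h.1)
    (fun o ho => (Protocol.eventually_transcript_viewAt (hfin ho)).mono fun n h => h.2.1)
    (fun o ho => (Protocol.eventually_transcript_viewAt (hfin ho)).mono fun n h => h.2.2)
    (fun htop n => ?_) ?_ ?_
  · have hiff (n : ℕ) {o o' : Outcome 𝒳 𝒴 𝒵}
        (ho : P.outcomeLaw (prodLaw pX pY) hP.terminates o ≠ 0)
        (ho' : P.outcomeLaw (prodLaw pX pY) hP.terminates o' ≠ 0) :=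
      Protocol.viewAt_eq_iff hP.prefixFree n (hfin ho) (hfin ho')
    have key := P.nonnegInteraction_viewLaw pX pY (fun n => ?_) n
    · rw [← P.map_viewAt _ hP.prefixFree hP.terminates, ← P.outcomeLaw_map_final, PMF.map_comp,
        nonnegInteraction_map] at key
      exact key.congr (fun o o' ho ho' => (hiff n ho ho').1)
        (fun o o' ho ho' => (hiff n ho ho').2.1) fun o o' ho ho' => (hiff n ho ho').2.2
    -- Finiteness is known for the truncated transcripts; for fixed n they induce the same partition
    -- as the histories, so it transfers.
    · rw [← P.map_viewAt _ hP.prefixFree hP.terminates, ← P.outcomeLaw_map_final, PMF.map_comp,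
        ent, condEnt_map]
      refine ne_of_eq_of_ne (condEnt_congr (fun _ _ _ _ => Iff.rfl) fun o o' ho ho' => ?_) (htop n)
      exact and_congr_left' (hiff n ho ho').1
  · refine condEnt_eq_zero_of_det fun o o' ho ho' h => ?_
    exact hP.x_eq_of_m1_eq hX hY hW ho ho' h
  · refine condEnt_eq_zero_of_det fun o o' ho ho' h => ?_
    exact hP.y_eq_of_m2_eq hX hY hW ho ho' h

end Main
end ThreeParty

end

/-! ### The three bounds -/

theorem mainTheorem4 {𝒳 𝒴 𝒵 : Type*} [Fintype 𝒳] [Fintype 𝒴] [Fintype 𝒵]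
    (pX : PMF 𝒳) (pY : PMF 𝒴) (hX : ∀ x, 0 < pX x) (hY : ∀ y, 0 < pY y)
    (W : 𝒳 → 𝒴 → PMF 𝒵) (hW : ThreeParty.NormalForm W)
    (P : ThreeParty.Protocol 𝒳 𝒴 𝒵) (hP : P.IsSecure (ThreeParty.prodLaw pX pY) W)
    (pXYZ : PMF (𝒳 × 𝒴 × 𝒵))
    (hXYZ : pXYZ = ThreeParty.targetLaw (ThreeParty.prodLaw pX pY) W)
    (outcome : PMF (ThreeParty.Outcome 𝒳 𝒴 𝒵))
    (houtcome : outcome = P.outcomeLaw (ThreeParty.prodLaw pX pY) hP.terminates) :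
    -- `H(M₂₃) ≥ RI(X;Z) + H(Y,Z|X)`
    ENNReal.ofReal (ThreeParty.residualInfo (pXYZ.map fun w => (w.1, w.2.2)) +
        ThreeParty.condEntropy (pXYZ.map fun w => ((w.2.1, w.2.2), w.1))) ≤
      ThreeParty.entropy (outcome.map ThreeParty.Outcome.m23) ∧
    -- `H(M₃₁) ≥ RI(Y;Z) + H(X,Z|Y)`
    ENNReal.ofReal (ThreeParty.residualInfo (pXYZ.map fun w => (w.2.1, w.2.2)) +
        ThreeParty.condEntropy (pXYZ.map fun w => ((w.1, w.2.2), w.2.1))) ≤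
      ThreeParty.entropy (outcome.map ThreeParty.Outcome.m31) ∧
    -- `H(M₁₂) ≥ RI(X;Z) + RI(Y;Z) + H(X,Y|Z)`
    ENNReal.ofReal (ThreeParty.residualInfo (pXYZ.map fun w => (w.1, w.2.2)) +
        ThreeParty.residualInfo (pXYZ.map fun w => (w.2.1, w.2.2)) +
        ThreeParty.condEntropy (pXYZ.map fun w => ((w.1, w.2.1), w.2.2))) ≤
      ThreeParty.entropy (outcome.map ThreeParty.Outcome.m12) := by
  have hA : ThreeParty.IsMarkovChain outcome ThreeParty.Outcome.m1 ThreeParty.Outcome.x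
      fun o => (o.y, o.z) := houtcome ▸ hP.private_alice
  have hB : ThreeParty.IsMarkovChain outcome ThreeParty.Outcome.m2 ThreeParty.Outcome.y
      fun o => (o.x, o.z) := houtcome ▸ hP.private_bob
  have hC : ThreeParty.IsMarkovChain outcome ThreeParty.Outcome.m3 ThreeParty.Outcome.z
      fun o => (o.x, o.y) := houtcome ▸ hP.private_charlie
  have hx {o o'} (ho : outcome o ≠ 0) (ho' : outcome o' ≠ 0) (h : o'.m1 = o.m1) : o'.x = o.x := by
    subst houtcome; exact hP.x_eq_of_m1_eq hX hY hW ho ho' h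
  have hy {o o'} (ho : outcome o ≠ 0) (ho' : outcome o' ≠ 0) (h : o'.m2 = o.m2) : o'.y = o.y := by
    subst houtcome; exact hP.y_eq_of_m2_eq hX hY hW ho ho' h
  have hz {o o'} (ho : outcome o ≠ 0) (ho' : outcome o' ≠ 0) (h : o'.m3 = o.m3) : o'.z = o.z := by
    subst houtcome; exact hP.z_eq_of_m3_eq hX hY hW ho ho' h
  have hAB := hP.condEnt_add_le_ent_m12 hX hY hW houtcome
  have hlaw : pXYZ = outcome.map fun o => (o.x, o.y, o.z) := by
    rw [hXYZ, houtcome, hP.correct]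
  rw [hlaw]
  simp only [PMF.map_comp]
  refine ⟨?_, ?_, ?_⟩
  · exact ThreeParty.residualInfo_add_condEntropy_le
      (A := ThreeParty.Outcome.m12) (C := ThreeParty.Outcome.m31)
      ((hA.map_right Prod.snd).map_left Prod.snd) ((hC.map_right Prod.fst).map_left Prod.snd) hA
      (fun o o' ho ho' h1 h2 => hy ho ho' (Prod.ext h1 h2))
      fun o o' ho ho' h1 h2 => hz ho ho' (Prod.ext h1 h2)
  -- The previous bound with Alice and Bob exchanged: links 23 and 31 trade roles.
  · exact ThreeParty.residualInfo_add_condEntropy_le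
      (A := ThreeParty.Outcome.m12) (C := ThreeParty.Outcome.m23)
      ((hB.map_right Prod.snd).map_left Prod.snd) ((hC.map_right Prod.snd).map_left Prod.fst) hB
      (fun o o' ho ho' h1 h2 => hx ho ho' (Prod.ext h1 h2))
      fun o o' ho ho' h1 h2 => hz ho ho' (Prod.ext h2 h1)
  · exact ThreeParty.residualInfo_add_residualInfo_add_condEntropy_le
      (B := ThreeParty.Outcome.m23) (C := ThreeParty.Outcome.m31)
      ((hA.map_right Prod.snd).map_left Prod.snd) ((hB.map_right Prod.snd).map_left Prod.snd) hC
      (fun o o' ho ho' h1 h2 => hz ho ho' (Prod.ext h1 h2)) hAB
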